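/- For $0\le p=p(n)\le 1$ let $G(n,p)$ be the random graph on $n$ labelled vertices in which each pair of vertices is joined independently with probability $p$; "a.a.s." means with probability tending to $1$ as $n\to\infty$, and all asymptotic notation refers to $n\to\infty$. For a finite graph $G=(V,E)$, a set $R\subseteq V$ is resolving if for any two distinct vertices $v,w\in V$ there is $z\in R$ with $\mathrm{dist}(v,z)\ne \mathrm{dist}(w,z)$; the metric dimension $\beta(G)$ is the smallest cardinality of a resolving set. Let $d=p(n-1)$ and suppose that $d\gg \log^3 n$ and $n-d\gg \log n$. Let $i=i(n)\ge 0$ be the largest integer such that $d^i=o(n)$ (that is, $d^{i}=o(n)$, and every $j=j(n)\in\mathbb{Z}_{\ge 0}$ with $d^{j}=o(n)$ satisfies $j\le i$ for all large $n$), let $c=c(n)=d^{i+1}/n$, suppose that $p=o(1)$ or $p=\Theta(1)$, and let $$q=\begin{cases}(e^{-c})^2+(1-e^{-c})^2 & \text{if } p=o(1),\\ p^2+(1-p)^2 & \text{if } p=\Theta(1).\end{cases}$$ Then the following holds for $G=G(n,p)$. (i) If $c=\Theta(1)$, then a.a.s. $$\beta(G)\le (1+o(1))\,\frac{2\log n}{\log(1/q)}.$$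 Here $\frac{2\log n}{\log(1/q)}=\Omega(\log n)$, and it is $\Theta(\log n)$ if $1-p=\Omega(1)$ (in particular if $p=o(1)$). (ii) If $c\to\infty$, then a.a.s. $$\beta(G)\le (1+o(1))\left(\frac{d^i}{n}+e^{-c}\right)^{-1}\log n,$$ where $\left(\frac{d^i}{n}+e^{-c}\right)^{-1}\log n\gg \log n$. In particular, a.a.s. $$\beta(G)\le \begin{cases}(1+o(1))\,e^{c}\log n=(1+o(1))\,\dfrac{2\log n}{\log(1/q)} & \text{if } e^{-c}\gg d^i/n,\\[2mm] (1+o(1))\,\dfrac{n\log n}{d^i} & \text{if } e^{-c}\ll d^i/n.\end{cases}$$ -/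

import Mathlib

open Filter Topology Asymptotics

/-- A set `R` of vertices is resolving if the vector of distances to the vertices of `R`
determines every vertex. Distances are graph distances with values in `ℕ∞`
(infinite between different components). -/
def SimpleGraph.IsResolvingSet {V : Type*} (G : SimpleGraph V) (R : Finset V) : Prop :=
  ∀ v w : V, v ≠ w → (fun z : R => G.edist v z) ≠ (fun z : R => G.edist w z)

/-- The whole vertex set is always resolving. -/
theorem SimpleGraph.isResolvingSet_univ {V : Type*} [Fintype V] (G : SimpleGraph V) :
    G.IsResolvingSet Finset.univ := by
  intro v w hvw h
  have h1 := congrFun h ⟨v, Finset.mem_univ v⟩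
  simp only [SimpleGraph.edist_self] at h1
  exact hvw (SimpleGraph.edist_eq_zero_iff.mp h1.symm).symm

/-- The metric dimension: the smallest cardinality of a resolving set. -/
noncomputable def SimpleGraph.metricDimension {V : Type*} (G : SimpleGraph V) : ℕ :=
  sInf {k : ℕ | ∃ R : Finset V, G.IsResolvingSet R ∧ R.card = k}

/-- An assertion about `G(n,p)`, `p = p(n)`, holds asymptotically almost surely. -/
def HoldsAas (p : ℕ → unitInterval) (A : ∀ n : ℕ, Set (SimpleGraph (Fin n))) : Prop :=
  Tendsto (fun n => (SimpleGraph.binomialRandom (Fin n) (p n)).real (A n)) atTop (𝓝 1)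

/-- A.a.s. `β(G(n,p)) ≤ (1 + o(1)) f(n)`. -/
def MetricDimensionAasLe (p : ℕ → unitInterval) (f : ℕ → ℝ) : Prop :=
  ∃ δ : ℕ → ℝ, Tendsto δ atTop (𝓝 0) ∧
    HoldsAas p (fun n => {G | (G.metricDimension : ℝ) ≤ (1 + δ n) * f n})

/-- The expected average degree `d = p (n - 1)`. -/
noncomputable def avgDegree (p : ℕ → unitInterval) (n : ℕ) : ℝ := (p n : ℝ) * ((n : ℝ) - 1)

/-- `i = i(n) ≥ 0` is (for all large `n`) the largest integer such that `d ^ i = o(n)`. -/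
def IsLargestExponent (d : ℕ → ℝ) (i : ℕ → ℕ) : Prop :=
  ((fun n => d n ^ i n) =o[atTop] (fun n : ℕ => (n : ℝ))) ∧
    ∀ j : ℕ → ℕ, ((fun n => d n ^ j n) =o[atTop] (fun n : ℕ => (n : ℝ))) →
      ∀ᶠ n in atTop, j n ≤ i n

/-- `q = (e^{-c})^2 + (1 - e^{-c})^2` if `p = o(1)`, and `q = p^2 + (1 - p)^2` if `p = Θ(1)`. -/
def IsCollisionParameter (p : ℕ → unitInterval) (c q : ℕ → ℝ) : Prop :=
  ((fun n => (p n : ℝ)) =o[atTop] (fun _ => (1 : ℝ)) ∧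
      ∀ n, q n = Real.exp (-c n) ^ 2 + (1 - Real.exp (-c n)) ^ 2) ∨
    ((fun n => (p n : ℝ)) =Θ[atTop] (fun _ => (1 : ℝ)) ∧ ∀ n, q n = (p n : ℝ) ^ 2 + (1 - (p n : ℝ)) ^ 2)

/-! Suppose first that `p → 0`, so that `i ≥ 1` eventually. Fix `v ≠ w` and explore the graph from
both at once, a vertex reached from both sides in the same round being given to `w`. The frontier of
`v` after `j` rounds then consists of vertices at distance at most `j` from `v` and more than `j`
from `w`. As long as `d ^ j` is small compared with `n`, few vertices are used up or contested, and
the frontier has size about `d ^ j`; this lasts up to `j = i`. In round `i + 1` each of the `(1 -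
o(1)) n` unexplored vertices meets the frontier with probability about `1 - x` and misses the rival
set with probability about `x`, where `x = e^{-c}`. So about `d ^ i + n x (1 - x)` vertices, or
more, are closer to `v` than to `w`. Each round reveals only fresh edges, so Chernoff bounds can be
applied round by round (`Exploration.measureReal_run_le`); the failure probability `O((i + 1) n⁻⁴)`
survives a union bound over all pairs (`holdsAas_le_closerCount`).

Exchanging `v` and `w` doubles the count, so a proportion of about `2 (d ^ i / n + x (1 - x))` of
the vertices separates any given pair. By a first-moment argument `r` random vertices form a
resolving set once `n ^ 2 (1 - s / n) ^ r < 1`, with `s` the number of separators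
(`SimpleGraph.metricDimension_le_of_separators`). If `c` is bounded below, the identity `2 x (1 - x)
= 1 - q` yields `r ≈ 2 log n / log (1 / q)`. If `c → ∞`, the proportion tends to `0`, `x (1 - x) ~
x`, and `r ≈ (d ^ i / n + x)⁻¹ log n`.

The condition `d ≫ log³ n` is what the last round needs. A relative error `η ≈ √(log n / d)` in the
size of the rival set changes `e^{-c}` by a factor `e^{O(c η)}`. Either the last layer is negligible
against `d ^ i`, or `c ≤ log n`, and then `c η → 0`.

If `p = Θ(1)`, adjacency alone suffices: a fixed set of `r` vertices fails to resolve some pair with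
probability at most `n ^ 2 q ^ r`. Here `c` stays bounded, so `c → ∞` forces `p → 0`. -/

/-! ### Independence and Chernoff bounds for events on disjoint sets of coordinates. -/

section ProductProbability

open MeasureTheory ProbabilityTheory

variable {ι κ : Type*} [Fintype ι] {μ : Measure (ι → Prop)}

theorem integral_mul_of_dependsOn (h : iIndepFun (fun i (ω : ι → Prop) => ω i) μ)
    {f g : (ι → Prop) → ℝ} {S T : Finset ι} (hST : Disjoint S T)
    (hf : DependsOn f (S : Set ι)) (hg : DependsOn g (T : Set ι)) :
    ∫ ω, f ω * g ω ∂μ = (∫ ω, f ω ∂μ) * ∫ ω, g ω ∂μ := by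
  obtain ⟨f', rfl⟩ := dependsOn_iff_exists_comp.mp hf
  obtain ⟨g', rfl⟩ := dependsOn_iff_exists_comp.mp hg
  have hi := h.indepFun_finset S T hST (fun i => measurable_pi_apply i)
  have hi' := hi.comp (φ := f') (ψ := g') .of_discrete .of_discrete
  exact hi'.integral_fun_mul_eq_mul_integral
    (Measurable.of_discrete.aestronglyMeasurable) (Measurable.of_discrete.aestronglyMeasurable)

theorem integral_ite_one (P : (ι → Prop) → Prop) [DecidablePred P] :
    ∫ ω, (if P ω then (1 : ℝ) else 0) ∂μ = μ.real {ω | P ω} := by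
  rw [← integral_indicator_one (μ := μ) (s := {ω | P ω}) .of_discrete]
  congr 1
  ext ω
  simp [Set.indicator]

theorem measureReal_and_of_dependsOn (h : iIndepFun (fun i (ω : ι → Prop) => ω i) μ)
    {P Q : (ι → Prop) → Prop} {S T : Finset ι} (hST : Disjoint S T)
    (hP : DependsOn P (S : Set ι)) (hQ : DependsOn Q (T : Set ι)) :
    μ.real {ω | P ω ∧ Q ω} = μ.real {ω | P ω} * μ.real {ω | Q ω} := by
  classical
  rw [← integral_ite_one, ← integral_ite_one, ← integral_ite_one,
    ← integral_mul_of_dependsOn h hST]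
  · congr 1; ext ω; split_ifs <;> simp_all
  · intro x y hxy; simp only [hP hxy]
  · intro x y hxy; simp only [hQ hxy]

variable [IsProbabilityMeasure μ]

theorem integral_prod_of_dependsOn [DecidableEq ι]
    (h : iIndepFun (fun i (ω : ι → Prop) => ω i) μ)
    (U : Finset κ) (f : κ → (ι → Prop) → ℝ) (S : κ → Finset ι)
    (hS : (U : Set κ).PairwiseDisjoint S)
    (hf : ∀ z ∈ U, DependsOn (f z) (S z : Set ι)) :
    ∫ ω, ∏ z ∈ U, f z ω ∂μ = ∏ z ∈ U, ∫ ω, f z ω ∂μ := by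
  classical
  induction U using Finset.induction_on with
  | empty => simp
  | insert a U ha ih =>
    simp only [Finset.prod_insert ha]
    rw [← ih (hS.subset (by simp)) (fun z hz => hf z (Finset.mem_insert_of_mem hz))]
    refine integral_mul_of_dependsOn h (S := S a) (T := U.biUnion S) ?_
      (hf a (Finset.mem_insert_self _ _)) ?_
    · rw [Finset.disjoint_biUnion_right]
      intro z hz
      exact hS (by simp) (by simp [hz]) (fun e => ha (e ▸ hz))
    · intro x y hxy
      refine Finset.prod_congr rfl fun z hz => hf z (Finset.mem_insert_of_mem hz) fun i hi => ?_
      exact hxy i (by simpa using ⟨z, hz, hi⟩)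

theorem measureReal_forall_of_dependsOn [DecidableEq ι]
    (h : iIndepFun (fun i (ω : ι → Prop) => ω i) μ)
    (U : Finset κ) (P : κ → (ι → Prop) → Prop) (S : κ → Finset ι)
    (hS : (U : Set κ).PairwiseDisjoint S)
    (hP : ∀ z ∈ U, DependsOn (P z) (S z : Set ι)) :
    μ.real {ω | ∀ z ∈ U, P z ω} = ∏ z ∈ U, μ.real {ω | P z ω} := by
  classical
  simp_rw [← integral_ite_one]
  rw [← integral_prod_of_dependsOn h U _ S hS]
  · simp only [Finset.prod_boole]
  · intro z hz x y hxy; simp only [hP z hz hxy]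

/-- The moment generating function factorises over the independent indicators, and each factor `1 +
(e^θ - 1) P` is at most its exponential. Both Chernoff tails below come from this. -/
theorem integral_exp_mul_card_le [DecidableEq ι]
    (h : iIndepFun (fun i (ω : ι → Prop) => ω i) μ)
    (U : Finset κ) (P : κ → (ι → Prop) → Prop) [∀ ω, DecidablePred fun z => P z ω]
    (S : κ → Finset ι)
    (hS : (U : Set κ).PairwiseDisjoint S)
    (hP : ∀ z ∈ U, DependsOn (P z) (S z : Set ι)) (θ : ℝ) :
    ∫ ω, Real.exp (θ * (U.filter fun z => P z ω).card) ∂μ ≤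
      Real.exp ((Real.exp θ - 1) * ∑ z ∈ U, μ.real {ω | P z ω}) := by
  have e1 : ∀ ω, Real.exp (θ * (U.filter fun z => P z ω).card) =
      ∏ z ∈ U, (1 + (Real.exp θ - 1) * (if P z ω then (1 : ℝ) else 0)) := by
    intro ω
    rw [Finset.card_filter, Nat.cast_sum, Finset.mul_sum, Real.exp_sum]
    refine Finset.prod_congr rfl fun z _ => ?_
    split_ifs <;> simp
  simp_rw [e1]
  rw [integral_prod_of_dependsOn h U _ S hS
    (fun z hz x y hxy => by simp only [hP z hz hxy]), Finset.mul_sum, Real.exp_sum]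
  refine Finset.prod_le_prod (fun z _ => integral_nonneg fun ω => ?_) fun z _ => ?_
  · simp only [Pi.zero_apply]
    split_ifs
    · simp [Real.exp_nonneg]
    · simp
  · rw [integral_add (integrable_const _) Integrable.of_finite, integral_const_mul,
      integral_ite_one]
    simp only [integral_const, probReal_univ, smul_eq_mul, mul_one]
    linarith [Real.add_one_le_exp ((Real.exp θ - 1) * μ.real {ω | P z ω})]

/-- Markov's inequality for the exponential with parameter `t / 2`, together with `e^{t/2} - 1 ≤ t/2
+ t²/4`. Here `M` need only bound the mean from above, so that thresholds can be chosen
independently of the exact state of the exploration. -/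
theorem measureReal_card_ge_le [DecidableEq ι]
    (h : iIndepFun (fun i (ω : ι → Prop) => ω i) μ)
    (U : Finset κ) (P : κ → (ι → Prop) → Prop) [∀ ω, DecidablePred fun z => P z ω]
    (S : κ → Finset ι)
    (hS : (U : Set κ).PairwiseDisjoint S)
    (hP : ∀ z ∈ U, DependsOn (P z) (S z : Set ι)) {M t : ℝ}
    (hM : ∑ z ∈ U, μ.real {ω | P z ω} ≤ M) (ht0 : 0 ≤ t) (ht1 : t ≤ 1) :
    μ.real {ω | (1 + t) * M ≤ (U.filter fun z => P z ω).card} ≤ Real.exp (-(t ^ 2 * M / 4)) := by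
  have hM0 : 0 ≤ M := (Finset.sum_nonneg fun z _ => measureReal_nonneg).trans hM
  have h1 := measure_ge_le_exp_mul_mgf (μ := μ) (X := fun ω => ((U.filter fun z => P z ω).card : ℝ))
    ((1 + t) * M) (t := t / 2) (by positivity) Integrable.of_finite
  refine h1.trans ?_
  have h2 := integral_exp_mul_card_le h U P S hS hP (t / 2)
  have h3 : Real.exp (t / 2) - 1 ≤ t / 2 + (t / 2) ^ 2 := by
    have := Real.abs_exp_sub_one_sub_id_le (x := t / 2) (by rw [abs_le]; constructor <;> linarith)
    linarith [(abs_le.mp this).2]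
  have h4 : 0 ≤ Real.exp (t / 2) - 1 := by linarith [Real.add_one_le_exp (t / 2)]
  calc _ ≤ Real.exp (-(t / 2) * ((1 + t) * M)) *
        Real.exp ((Real.exp (t / 2) - 1) * ∑ z ∈ U, μ.real {ω | P z ω}) := by
        gcongr; exact h2
    _ = Real.exp (-(t / 2) * ((1 + t) * M) +
        (Real.exp (t / 2) - 1) * ∑ z ∈ U, μ.real {ω | P z ω}) := by rw [Real.exp_add]
    _ ≤ _ := by
        apply Real.exp_le_exp.mpr
        nlinarith [mul_le_mul h3 hM (Finset.sum_nonneg fun z _ => measureReal_nonneg)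
          (by positivity)]

theorem measureReal_card_le_le [DecidableEq ι]
    (h : iIndepFun (fun i (ω : ι → Prop) => ω i) μ)
    (U : Finset κ) (P : κ → (ι → Prop) → Prop) [∀ ω, DecidablePred fun z => P z ω]
    (S : κ → Finset ι)
    (hS : (U : Set κ).PairwiseDisjoint S)
    (hP : ∀ z ∈ U, DependsOn (P z) (S z : Set ι)) {M t : ℝ}
    (hM : M ≤ ∑ z ∈ U, μ.real {ω | P z ω}) (ht0 : 0 ≤ t) (ht1 : t ≤ 1) :
    μ.real {ω | ((U.filter fun z => P z ω).card : ℝ) ≤ (1 - t) * M} ≤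
      Real.exp (-(t ^ 2 * M / 4)) := by
  have h1 := measure_le_le_exp_mul_mgf (μ := μ) (X := fun ω => ((U.filter fun z => P z ω).card : ℝ))
    ((1 - t) * M) (t := -(t / 2)) (by linarith) Integrable.of_finite
  refine h1.trans ?_
  have h2 := integral_exp_mul_card_le h U P S hS hP (-(t / 2))
  have h3 : Real.exp (-(t / 2)) - 1 ≤ -(t / 2) + (t / 2) ^ 2 := by
    have := Real.abs_exp_sub_one_sub_id_le (x := -(t / 2))
      (by rw [abs_le]; constructor <;> linarith)
    have := (abs_le.mp this).2
    nlinarith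
  have h5 : -(t / 2) + (t / 2) ^ 2 ≤ 0 := by nlinarith
  calc _ ≤ Real.exp (-(-(t / 2)) * ((1 - t) * M)) *
        Real.exp ((Real.exp (-(t / 2)) - 1) * ∑ z ∈ U, μ.real {ω | P z ω}) := by
        gcongr; exact h2
    _ = Real.exp (-(-(t / 2)) * ((1 - t) * M) +
        (Real.exp (-(t / 2)) - 1) * ∑ z ∈ U, μ.real {ω | P z ω}) := by rw [Real.exp_add]
    _ ≤ _ := by
        apply Real.exp_le_exp.mpr
        -- The coefficient of the mean is at most `-(t/2) + t²/4 ≤ 0`, which is why a lower bound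
        -- `M` for the mean may replace it.
        nlinarith [mul_le_mul_of_nonneg_right h3
          (Finset.sum_nonneg fun z (_ : z ∈ U) => measureReal_nonneg (μ := μ) (s := {ω | P z ω})),
          mul_le_mul_of_nonpos_left hM h5]

end ProductProbability

/-! ### The random graph as a family of independent edge indicators. -/

section EdgeModel

open MeasureTheory ProbabilityTheory unitInterval

/-- The law of independent edge indicators, with edge probability `p`. -/
noncomputable def edgeMeasure (V : Type*) (p : unitInterval) : Measure (Sym2 V → Prop) :=
  Measure.infinitePi fun e : Sym2 V =>
    toNNReal p • Measure.dirac (¬ e.IsDiag) + toNNReal (σ p) • Measure.dirac False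

/-- The graph whose edges are the pairs with a true indicator. -/
def graphOfEdges {V : Type*} (ω : Sym2 V → Prop) : SimpleGraph V :=
  SimpleGraph.fromEdgeSet {e | ω e}

variable {V : Type*}

theorem graphOfEdges_adj (ω : Sym2 V → Prop) (x y : V) :
    (graphOfEdges ω).Adj x y ↔ ω s(x, y) ∧ x ≠ y := by
  simp [graphOfEdges]

theorem isProbabilityMeasure_edge (p : unitInterval) (e : Sym2 V) : IsProbabilityMeasure
    (toNNReal p • Measure.dirac (¬ e.IsDiag) + toNNReal (σ p) • Measure.dirac False) := by
  constructor
  simp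

instance (p : unitInterval) : IsProbabilityMeasure (edgeMeasure V p) := by
  have := isProbabilityMeasure_edge (V := V) p
  unfold edgeMeasure
  infer_instance

theorem iIndepFun_edgeMeasure (p : unitInterval) :
    iIndepFun (fun e (ω : Sym2 V → Prop) => ω e) (edgeMeasure V p) := by
  have := isProbabilityMeasure_edge (V := V) p
  exact iIndepFun_infinitePi (X := fun _ => id) (fun _ => measurable_id)

theorem edgeMeasure_real_edge (p : unitInterval) {x y : V} (hxy : x ≠ y) :
    (edgeMeasure V p).real {ω | ω s(x, y)} = p := by
  have := isProbabilityMeasure_edge (V := V) p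
  have h := measurePreserving_eval_infinitePi (fun e : Sym2 V =>
    toNNReal p • Measure.dirac (¬ e.IsDiag) + toNNReal (σ p) • Measure.dirac False) s(x, y)
  have h2 := h.measureReal_preimage (s := {True}) (MeasurableSet.of_discrete).nullMeasurableSet
  have h3 : (edgeMeasure V p).real {ω | ω s(x, y)} =
      (edgeMeasure V p).real (Function.eval s(x, y) ⁻¹' {True}) := by
    congr 1; ext ω; simp
  rw [h3]
  refine h2.trans ?_
  simp [measureReal_def, hxy]

theorem binomialRandom_real_eq [Fintype V] (p : unitInterval) (S : Set (SimpleGraph V)) :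
    (SimpleGraph.binomialRandom V p).real S = (edgeMeasure V p).real {ω | graphOfEdges ω ∈ S} := by
  rw [SimpleGraph.binomialRandom_eq_map, measureReal_def, measureReal_def,
    Measure.map_apply SimpleGraph.measurable_fromEdgeSet 
      (SimpleGraph.measurableEmbedding_edgeSet.measurableSet_image.mp .of_discrete),
    setBernoulli_apply']
  -- The factors of `edgeMeasure`, including the `¬ e.IsDiag` that excludes loops, are written so
  -- that this agrees with the Bernoulli random set by definition.
  rfl

end EdgeModel

/-! ### Simultaneous breadth-first exploration from two roots, and its meaning for distances. -/

section Exploration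

/-- State of the simultaneous breadth-first exploration from two roots: the unexplored vertices,
the frontier vertices reached by the first root only, and those reached by the second root. -/
@[ext]
structure Exploration (V : Type*) where
  unexplored : Finset V
  frontier : Finset V
  rival : Finset V

namespace Exploration

variable {V : Type*}

open Classical in
/-- The unexplored vertices adjacent to the frontier but not to the rival set. -/
noncomputable def newFrontier (G : SimpleGraph V) (s : Exploration V) : Finset V :=
  s.unexplored.filter fun z => (∃ a ∈ s.frontier, G.Adj z a) ∧ ∀ b ∈ s.rival, ¬ G.Adj z b

open Classical in
/-- The unexplored vertices adjacent to the rival set. -/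
noncomputable def newRival (G : SimpleGraph V) (s : Exploration V) : Finset V :=
  s.unexplored.filter fun z => ∃ b ∈ s.rival, G.Adj z b

open Classical in
/-- One step of the exploration. -/
noncomputable def step (G : SimpleGraph V) (s : Exploration V) : Exploration V where
  unexplored := (s.unexplored \ s.newFrontier G) \ s.newRival G
  frontier := s.newFrontier G
  rival := s.newRival G

/-- `k` steps of the exploration. -/
noncomputable def run (G : SimpleGraph V) : ℕ → Exploration V → Exploration V
  | 0, s => s
  | k + 1, s => run G k (s.step G)

theorem run_succ' (G : SimpleGraph V) (k : ℕ) (s : Exploration V) :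
    run G (k + 1) s = (run G k s).step G := by
  induction k generalizing s with
  | zero => rfl
  | succ k ih => exact ih (s.step G)

/-- The three parts of the state are disjoint. -/
def WF (s : Exploration V) : Prop :=
  Disjoint s.unexplored s.frontier ∧ Disjoint s.unexplored s.rival ∧ Disjoint s.frontier s.rival

theorem WF.step {s : Exploration V} (G : SimpleGraph V) : (s.step G).WF := by
  classical
  refine ⟨?_, ?_, ?_⟩ <;> rw [Finset.disjoint_left] <;> intro x <;>
    simp +contextual [Exploration.step, newFrontier, newRival]
  grind

/-- A round inspects only pairs between the unexplored part and the two active sets. With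
`run_congr` this is the deterministic half of the principle of deferred decisions. -/
theorem step_congr {G G' : SimpleGraph V} {s : Exploration V}
    (h : ∀ x ∈ s.unexplored, ∀ y, y ∈ s.frontier ∨ y ∈ s.rival → (G.Adj x y ↔ G'.Adj x y)) :
    s.step G = s.step G' := by
  classical
  have h1 : s.newFrontier G = s.newFrontier G' := by
    refine Finset.filter_congr fun x hx => ?_
    exact and_congr (exists_congr fun a => and_congr_right fun ha => h x hx a (Or.inl ha))
      (forall_congr' fun b => imp_congr_right fun hb => not_congr (h x hx b (Or.inr hb)))
  have h2 : s.newRival G = s.newRival G' := by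
    refine Finset.filter_congr fun x hx => ?_
    exact exists_congr fun a => and_congr_right fun ha => h x hx a (Or.inr ha)
  simp only [step, h1, h2]

theorem step_unexplored_subset (G : SimpleGraph V) (s : Exploration V) :
    (s.step G).unexplored ⊆ s.unexplored := by
  classical
  exact Finset.sdiff_subset.trans Finset.sdiff_subset

theorem step_frontier_subset (G : SimpleGraph V) (s : Exploration V) :
    (s.step G).frontier ⊆ s.unexplored := by
  classical
  exact Finset.filter_subset _ _

theorem step_rival_subset (G : SimpleGraph V) (s : Exploration V) :
    (s.step G).rival ⊆ s.unexplored := by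
  classical
  exact Finset.filter_subset _ _

theorem run_congr {G G' : SimpleGraph V} (k : ℕ) {s : Exploration V}
    (h : ∀ x ∈ s.unexplored, ∀ y, y ∈ s.unexplored ∨ y ∈ s.frontier ∨ y ∈ s.rival →
      (G.Adj x y ↔ G'.Adj x y)) :
    run G k s = run G' k s := by
  induction k generalizing s with
  | zero => rfl
  | succ k ih =>
    have e : s.step G = s.step G' := step_congr fun x hx y hy => h x hx y (Or.inr hy)
    rw [run, run, e]
    refine ih fun x hx y hy => h x (step_unexplored_subset _ _ hx) y (Or.inl ?_)
    rcases hy with hy | hy | hy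
    exacts [step_unexplored_subset _ _ hy, step_frontier_subset _ _ hy, step_rival_subset _ _ hy]

/-- What a state reached after `j` steps from `v` and `w` says about distances. -/
structure Tracks (G : SimpleGraph V) (v w : V) (j : ℕ) (s : Exploration V) : Prop where
  frontier_le : ∀ z ∈ s.frontier, G.edist v z ≤ j
  frontier_lt : ∀ z ∈ s.frontier, (j : ℕ∞) < G.edist w z
  unexplored_lt : ∀ z ∈ s.unexplored, (j : ℕ∞) < G.edist w z
  not_adj : ∀ y, y ∉ s.unexplored → y ∉ s.frontier → y ∉ s.rival →
    ∀ z ∈ s.unexplored, ¬ G.Adj z y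

/-- Consider the last edge `y z` of a walk from `w` to `z` of length at most `j + 1`. Then `y` is
within distance `j` of `w`, hence neither unexplored nor in the frontier. It is not in the rival set
by assumption, and vertices discarded in earlier rounds have no unexplored neighbours left. -/
theorem Tracks.lt_of_not_adj {G : SimpleGraph V} {v w : V} {j : ℕ} {s : Exploration V}
    (h : Tracks G v w j s) {z : V} (hz : z ∈ s.unexplored)
    (hadj : ∀ b ∈ s.rival, ¬ G.Adj z b) : ((j + 1 : ℕ) : ℕ∞) < G.edist w z := by
  by_contra hcon
  push Not at hcon
  have hne : G.edist w z ≠ ⊤ := fun e => by simp [e] at hcon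
  obtain ⟨p, hp⟩ := SimpleGraph.exists_walk_of_edist_ne_top hne
  have hlen : p.length ≤ j + 1 := by rw [← hp] at hcon; exact_mod_cast hcon
  have hwz : w ≠ z := by
    rintro rfl
    have := h.unexplored_lt w hz
    simp at this
  obtain ⟨y, hy, q, hq⟩ : ∃ y, G.Adj z y ∧ ∃ q : G.Walk y w, q.length + 1 = p.length := by
    have : ∀ r : G.Walk z w, ∃ y, G.Adj z y ∧ ∃ q : G.Walk y w, q.length + 1 = r.length := by
      intro r
      cases r with
      | nil => exact absurd rfl hwz
      | cons hadj q => exact ⟨_, hadj, q, rfl⟩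
    simpa using this p.reverse
  have hyd : G.edist w y ≤ j := by
    rw [SimpleGraph.edist_comm]
    refine (SimpleGraph.edist_le q).trans ?_
    exact_mod_cast (by omega : q.length ≤ j)
  by_cases h1 : y ∈ s.unexplored
  · exact absurd (h.unexplored_lt y h1) hyd.not_gt
  by_cases h2 : y ∈ s.frontier
  · exact absurd (h.frontier_lt y h2) hyd.not_gt
  by_cases h3 : y ∈ s.rival
  · exact hadj y h3 hy
  · exact h.not_adj y h1 h2 h3 z hz hy

theorem Tracks.step {G : SimpleGraph V} {v w : V} {j : ℕ} {s : Exploration V}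
    (h : Tracks G v w j s) : Tracks G v w (j + 1) (s.step G) := by
  classical
  refine ⟨?_, ?_, ?_, ?_⟩
  · intro z hz
    simp only [Exploration.step, newFrontier, Finset.mem_filter] at hz
    obtain ⟨-, ⟨a, ha, hza⟩, -⟩ := hz
    refine (SimpleGraph.edist_triangle (v := a)).trans ?_
    push_cast
    exact add_le_add (h.frontier_le a ha) (SimpleGraph.edist_eq_one_iff_adj.mpr hza.symm).le
  · intro z hz
    simp only [Exploration.step, newFrontier, Finset.mem_filter] at hz
    exact h.lt_of_not_adj hz.1 hz.2.2
  · intro z hz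
    simp only [Exploration.step, newFrontier, newRival, Finset.mem_filter, Finset.mem_sdiff] at hz
    exact h.lt_of_not_adj hz.1.1 (fun b hb hadj => hz.2 ⟨hz.1.1, b, hb, hadj⟩)
  -- An unexplored neighbour of either active set would have been absorbed by one of the two new
  -- layers, so the old active sets become inert.
  · intro y h1 h2 h3 z hz hadj
    simp only [Exploration.step, newFrontier, newRival, Finset.mem_filter, Finset.mem_sdiff]
      at h1 h2 h3 hz
    have hyU : y ∉ s.unexplored := fun hy => h1 ⟨⟨hy, h2⟩, h3⟩
    have hyF : y ∉ s.frontier := fun hy => by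
      by_cases hD : ∃ b ∈ s.rival, G.Adj z b
      · exact hz.2 ⟨hz.1.1, hD⟩
      · push Not at hD
        exact hz.1.2 ⟨hz.1.1, ⟨y, hy, hadj⟩, hD⟩
    have hyD : y ∉ s.rival := fun hy => hz.2 ⟨hz.1.1, y, hy, hadj⟩
    exact h.not_adj y hyU hyF hyD z hz.1.1 hadj

open Classical in
/-- The initial state with roots `v` and `w`. -/
noncomputable def start [Fintype V] (v w : V) : Exploration V where
  unexplored := Finset.univ \ {v, w}
  frontier := {v}
  rival := {w}

theorem tracks_start [Fintype V] (G : SimpleGraph V) {v w : V} (hvw : v ≠ w) :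
    Tracks G v w 0 (start v w) := by
  classical
  refine ⟨?_, ?_, ?_, ?_⟩
  · simp [start]
  · simp [start, SimpleGraph.edist_pos_of_ne hvw.symm]
  · intro z hz
    simp only [start, Finset.mem_sdiff, Finset.mem_insert, Finset.mem_singleton] at hz
    rw [Nat.cast_zero]
    exact SimpleGraph.edist_pos_of_ne (fun e => hz.2 (Or.inr e.symm))
  · intro y h1 h2 h3
    simp [start] at h1 h2 h3
    tauto

theorem tracks_run [Fintype V] (G : SimpleGraph V) {v w : V} (hvw : v ≠ w) (k : ℕ) :
    Tracks G v w k (run G k (start v w)) := by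
  induction k with
  | zero => exact tracks_start G hvw
  | succ k ih => rw [run_succ']; exact ih.step

theorem wf_start [Fintype V] {v w : V} (hvw : v ≠ w) : (start v w).WF := by
  classical
  refine ⟨?_, ?_, ?_⟩ <;> simp [start, hvw]

theorem wf_run [Fintype V] (G : SimpleGraph V) {v w : V} (hvw : v ≠ w) (k : ℕ) :
    (run G k (start v w)).WF := by
  cases k with
  | zero => exact wf_start hvw
  | succ k => rw [run_succ']; exact WF.step G

open Classical in
-- Frontier vertices at stage `j` satisfy `dist(v, z) ≤ j < dist(w, z)`. Consecutive frontiers are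
-- disjoint because the later one is drawn from the unexplored part. Only these two layers are
-- needed, the earlier ones being of smaller order.
theorem card_frontier_add_card_frontier_le [Fintype V] (G : SimpleGraph V) {v w : V}
    (hvw : v ≠ w) (k : ℕ) :
    (run G k (start v w)).frontier.card + (run G (k + 1) (start v w)).frontier.card ≤
      (Finset.univ.filter fun z => G.edist v z < G.edist w z).card := by
  have hdis : Disjoint (run G k (start v w)).frontier (run G (k + 1) (start v w)).frontier := by
    rw [run_succ']
    exact (wf_run G hvw k).1.symm.mono_right (step_frontier_subset _ _)
  rw [← Finset.card_union_of_disjoint hdis]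
  refine Finset.card_le_card fun z hz => ?_
  rw [Finset.mem_union] at hz
  rw [Finset.mem_filter]
  refine ⟨Finset.mem_univ _, ?_⟩
  rcases hz with hz | hz
  · exact ((tracks_run G hvw k).frontier_le z hz).trans_lt ((tracks_run G hvw k).frontier_lt z hz)
  · exact ((tracks_run G hvw (k + 1)).frontier_le z hz).trans_lt
      ((tracks_run G hvw (k + 1)).frontier_lt z hz)

end Exploration

end Exploration

/-! ### One-round probabilities, and the chaining of rounds. -/

section ExplorationProbability

open MeasureTheory ProbabilityTheory

variable {V : Type*}

theorem adj_congr_of_mem {ω ω' : Sym2 V → Prop} {x y : V} (h : ω s(x, y) = ω' s(x, y)) :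
    (graphOfEdges ω).Adj x y ↔ (graphOfEdges ω').Adj x y := by
  simp [graphOfEdges_adj, h]

theorem one_sub_one_sub_pow_le (p : unitInterval) (k : ℕ) :
    1 - (1 - (p : ℝ)) ^ k ≤ p * k := by
  have := one_add_mul_le_pow (a := -(p : ℝ)) (by linarith [p.2.2]) k
  rw [← sub_eq_add_neg] at this
  linarith

theorem Exploration.WF.notMem_frontier {s : Exploration V} (hs : s.WF) {z : V}
    (hz : z ∈ s.unexplored) : z ∉ s.frontier :=
  fun h => Finset.disjoint_left.mp hs.1 hz h

theorem Exploration.WF.notMem_rival {s : Exploration V} (hs : s.WF) {z : V}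
    (hz : z ∈ s.unexplored) : z ∉ s.rival :=
  fun h => Finset.disjoint_left.mp hs.2.1 hz h

theorem measureReal_not_adj [Fintype V] (p : unitInterval) {z b : V} (h : z ≠ b) :
    (edgeMeasure V p).real {ω | ¬ (graphOfEdges ω).Adj z b} = 1 - p := by
  have e : {ω : Sym2 V → Prop | ¬ (graphOfEdges ω).Adj z b} = {ω | ω s(z, b)}ᶜ := by
    ext ω; simp [graphOfEdges_adj, h]
  rw [e, probReal_compl_eq_one_sub .of_discrete, edgeMeasure_real_edge p h]

theorem one_sub_pow_le_exp (p : unitInterval) (k : ℕ) :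
    (1 - (p : ℝ)) ^ k ≤ Real.exp (-(p * k)) := by
  calc (1 - (p : ℝ)) ^ k ≤ Real.exp (-p) ^ k := by
        refine pow_le_pow_left₀ (by linarith [p.2.2]) ?_ _
        linarith [Real.add_one_le_exp (-(p : ℝ))]
    _ = Real.exp (-(p * k)) := by rw [← Real.exp_nat_mul]; ring_nf

theorem Exploration.card_unexplored_le (G : SimpleGraph V) (s : Exploration V) :
    s.unexplored.card ≤ (s.step G).unexplored.card + (s.newFrontier G).card +
      (s.newRival G).card := by
  classical
  refine (Finset.card_le_card fun x hx => ?_ : s.unexplored.card ≤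
    ((s.step G).unexplored ∪ s.newFrontier G ∪ s.newRival G).card).trans
    ((Finset.card_union_le _ _).trans (Nat.add_le_add_right (Finset.card_union_le _ _) _))
  simp only [step, Finset.mem_union, Finset.mem_sdiff]
  tauto

variable [DecidableEq V]

/-- The pairs joining `z` to the elements of `S`. -/
def starEdges (z : V) (S : Finset V) : Finset (Sym2 V) := S.image fun b => s(z, b)

theorem mem_starEdges {z b : V} {S : Finset V} (hb : b ∈ S) : s(z, b) ∈ starEdges z S :=
  Finset.mem_image_of_mem _ hb

theorem starEdges_disjoint_of_ne {z z' : V} {S T : Finset V} (hne : z ≠ z') (hz : z ∉ T) :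
    Disjoint (starEdges z S) (starEdges z' T) := by
  simp only [starEdges, Finset.disjoint_left, Finset.mem_image]
  rintro _ ⟨a, -, rfl⟩ ⟨b, hb, he⟩
  simp only [Sym2.eq_iff] at he
  rcases he with ⟨rfl, -⟩ | ⟨-, rfl⟩
  exacts [hne rfl, hz hb]

theorem starEdges_disjoint {z : V} {S T : Finset V} (hST : Disjoint S T) :
    Disjoint (starEdges z S) (starEdges z T) := by
  rw [Finset.disjoint_left] at hST
  simp only [starEdges, Finset.disjoint_left, Finset.mem_image]
  rintro _ ⟨a, ha, rfl⟩ ⟨b, hb, he⟩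
  rw [Sym2.congr_right.mp he] at hb
  exact hST ha hb

theorem dependsOn_forall_not_adj (z : V) (S : Finset V) :
    DependsOn (fun ω : Sym2 V → Prop => ∀ b ∈ S, ¬ (graphOfEdges ω).Adj z b)
      (starEdges z S : Set (Sym2 V)) := by
  intro ω ω' h
  refine propext (forall_congr' fun b => imp_congr_right fun hb => not_congr ?_)
  exact adj_congr_of_mem (h _ (by exact_mod_cast mem_starEdges hb))

theorem dependsOn_exists_adj (z : V) (S : Finset V) :
    DependsOn (fun ω : Sym2 V → Prop => ∃ b ∈ S, (graphOfEdges ω).Adj z b)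
      (starEdges z S : Set (Sym2 V)) := by
  intro ω ω' h
  refine propext (exists_congr fun b => and_congr_right fun hb => ?_)
  exact adj_congr_of_mem (h _ (by exact_mod_cast mem_starEdges hb))

theorem pairwiseDisjoint_starEdges {U T : Finset V} (h : Disjoint U T) :
    (U : Set V).PairwiseDisjoint fun z => starEdges z T :=
  fun _ hz _ _ hne => starEdges_disjoint_of_ne hne
    (fun hT => Finset.disjoint_left.mp h (by exact_mod_cast hz) hT)

theorem Exploration.dependsOn_mem_newFrontier (s : Exploration V) (z : V) :
    DependsOn (fun ω : Sym2 V → Prop => (∃ a ∈ s.frontier, (graphOfEdges ω).Adj z a) ∧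
      ∀ b ∈ s.rival, ¬ (graphOfEdges ω).Adj z b)
      (starEdges z (s.frontier ∪ s.rival) : Set (Sym2 V)) := by
  intro ω ω' h
  have h1 := dependsOn_exists_adj z s.frontier (x := ω) (y := ω') fun e he => h e (by
    simp only [starEdges, Finset.coe_image] at he ⊢
    exact Set.image_mono (by simp) he)
  have h2 := dependsOn_forall_not_adj z s.rival (x := ω) (y := ω') fun e he => h e (by
    simp only [starEdges, Finset.coe_image] at he ⊢
    exact Set.image_mono (by simp) he)
  simp only at h1 h2 ⊢
  rw [h1, h2]

variable [Fintype V]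

theorem measureReal_forall_not_adj (p : unitInterval) {z : V} {S : Finset V} (hz : z ∉ S) :
    (edgeMeasure V p).real {ω | ∀ b ∈ S, ¬ (graphOfEdges ω).Adj z b} =
      (1 - (p : ℝ)) ^ S.card := by
  have := measureReal_forall_of_dependsOn (iIndepFun_edgeMeasure (V := V) p) S
    (fun b ω => ¬ (graphOfEdges ω).Adj z b) (fun b => starEdges z {b})
    (fun a _ b _ hab => starEdges_disjoint (by simpa using hab))
    (fun b _ ω ω' h => propext (not_congr (adj_congr_of_mem
      (h _ (by exact_mod_cast mem_starEdges (Finset.mem_singleton_self b))))))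
  rw [this, Finset.prod_congr rfl
    (fun b hb => measureReal_not_adj p (fun e : z = b => hz (e ▸ hb))), Finset.prod_const]

theorem measureReal_exists_adj (p : unitInterval) {z : V} {S : Finset V} (hz : z ∉ S) :
    (edgeMeasure V p).real {ω | ∃ b ∈ S, (graphOfEdges ω).Adj z b} =
      1 - (1 - (p : ℝ)) ^ S.card := by
  have e : {ω : Sym2 V → Prop | ∃ b ∈ S, (graphOfEdges ω).Adj z b} =
      {ω | ∀ b ∈ S, ¬ (graphOfEdges ω).Adj z b}ᶜ := by
    ext ω; simp
  rw [e, probReal_compl_eq_one_sub .of_discrete, measureReal_forall_not_adj p hz]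

namespace Exploration

variable {s : Exploration V}

theorem measureReal_mem_newFrontier (p : unitInterval) (hs : s.WF) {z : V}
    (hz : z ∈ s.unexplored) :
    (edgeMeasure V p).real {ω | (∃ a ∈ s.frontier, (graphOfEdges ω).Adj z a) ∧
      ∀ b ∈ s.rival, ¬ (graphOfEdges ω).Adj z b} =
      (1 - (1 - (p : ℝ)) ^ s.frontier.card) * (1 - (p : ℝ)) ^ s.rival.card := by
  rw [measureReal_and_of_dependsOn (iIndepFun_edgeMeasure (V := V) p)
    (starEdges_disjoint hs.2.2) (dependsOn_exists_adj z s.frontier)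
    (dependsOn_forall_not_adj z s.rival), measureReal_exists_adj p (hs.notMem_frontier hz),
    measureReal_forall_not_adj p (hs.notMem_rival hz)]

/-- The events for different unexplored vertices depend on disjoint stars of pairs, so the size of
the new layer is a sum of independent indicators. -/
theorem measureReal_card_newFrontier_le (p : unitInterval) (hs : s.WF) {M t : ℝ}
    (hM : M ≤ s.unexplored.card *
      ((1 - (1 - (p : ℝ)) ^ s.frontier.card) * (1 - (p : ℝ)) ^ s.rival.card))
    (ht0 : 0 ≤ t) (ht1 : t ≤ 1) :
    (edgeMeasure V p).real {ω | ((s.newFrontier (graphOfEdges ω)).card : ℝ) ≤ (1 - t) * M} ≤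
      Real.exp (-(t ^ 2 * M / 4)) := by
  classical
  have key : ∀ ω, s.newFrontier (graphOfEdges ω) = s.unexplored.filter fun z =>
      ((∃ a ∈ s.frontier, (graphOfEdges ω).Adj z a) ∧
      ∀ b ∈ s.rival, ¬ (graphOfEdges ω).Adj z b) := by
    intro ω; ext; simp [newFrontier]
  simp_rw [key]
  refine measureReal_card_le_le (iIndepFun_edgeMeasure (V := V) p) s.unexplored
    (fun z ω => (∃ a ∈ s.frontier, (graphOfEdges ω).Adj z a) ∧
      ∀ b ∈ s.rival, ¬ (graphOfEdges ω).Adj z b)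
    (fun z => starEdges z (s.frontier ∪ s.rival))
    (pairwiseDisjoint_starEdges (Finset.disjoint_union_right.mpr ⟨hs.1, hs.2.1⟩))
    (fun z _ => s.dependsOn_mem_newFrontier z) ?_ ht0 ht1
  rwa [Finset.sum_congr rfl fun z hz => measureReal_mem_newFrontier p hs hz, Finset.sum_const,
    nsmul_eq_mul]

theorem measureReal_le_card_newFrontier (p : unitInterval) (hs : s.WF) {M t : ℝ}
    (hM : s.unexplored.card * (p * s.frontier.card : ℝ) ≤ M) (ht0 : 0 ≤ t) (ht1 : t ≤ 1) :
    (edgeMeasure V p).real {ω | (1 + t) * M ≤ (s.newFrontier (graphOfEdges ω)).card} ≤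
      Real.exp (-(t ^ 2 * M / 4)) := by
  classical
  have key : ∀ ω, s.newFrontier (graphOfEdges ω) = s.unexplored.filter fun z =>
      ((∃ a ∈ s.frontier, (graphOfEdges ω).Adj z a) ∧
      ∀ b ∈ s.rival, ¬ (graphOfEdges ω).Adj z b) := by
    intro ω; ext; simp [newFrontier]
  simp_rw [key]
  refine measureReal_card_ge_le (iIndepFun_edgeMeasure (V := V) p) s.unexplored
    (fun z ω => (∃ a ∈ s.frontier, (graphOfEdges ω).Adj z a) ∧
      ∀ b ∈ s.rival, ¬ (graphOfEdges ω).Adj z b)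
    (fun z => starEdges z (s.frontier ∪ s.rival))
    (pairwiseDisjoint_starEdges (Finset.disjoint_union_right.mpr ⟨hs.1, hs.2.1⟩))
    (fun z _ => s.dependsOn_mem_newFrontier z) ?_ ht0 ht1
  rw [Finset.sum_congr rfl fun z hz => measureReal_mem_newFrontier p hs hz, Finset.sum_const,
    nsmul_eq_mul]
  refine le_trans ?_ hM
  refine mul_le_mul_of_nonneg_left ?_ (Nat.cast_nonneg _)
  refine le_trans ?_ (one_sub_one_sub_pow_le p s.frontier.card)
  have h0 : 0 ≤ 1 - (p : ℝ) := by linarith [p.2.2]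
  have h1 : 1 - (p : ℝ) ≤ 1 := by linarith [p.2.1]
  exact mul_le_of_le_one_right (by linarith [pow_le_one₀ h0 h1 (n := s.frontier.card)])
    (pow_le_one₀ h0 h1)

theorem measureReal_le_card_newRival (p : unitInterval) (hs : s.WF) {M t : ℝ}
    (hM : s.unexplored.card * (p * s.rival.card : ℝ) ≤ M) (ht0 : 0 ≤ t) (ht1 : t ≤ 1) :
    (edgeMeasure V p).real {ω | (1 + t) * M ≤ (s.newRival (graphOfEdges ω)).card} ≤
      Real.exp (-(t ^ 2 * M / 4)) := by
  classical
  have key : ∀ ω, s.newRival (graphOfEdges ω) = s.unexplored.filter fun z =>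
      (∃ b ∈ s.rival, (graphOfEdges ω).Adj z b) := by
    intro ω; ext; simp [newRival]
  simp_rw [key]
  refine measureReal_card_ge_le (iIndepFun_edgeMeasure (V := V) p) s.unexplored
    (fun z ω => ∃ b ∈ s.rival, (graphOfEdges ω).Adj z b)
    (fun z => starEdges z s.rival) (pairwiseDisjoint_starEdges hs.2.1)
    (fun z _ => dependsOn_exists_adj z s.rival) ?_ ht0 ht1
  rw [Finset.sum_congr rfl fun z hz => measureReal_exists_adj p (hs.notMem_rival hz),
    Finset.sum_const, nsmul_eq_mul]
  refine le_trans ?_ hM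
  gcongr
  exact one_sub_one_sub_pow_le p s.rival.card

open Classical in
-- Principle of deferred decisions: the first round uses only pairs from the unexplored part to the
-- active sets, while everything afterwards uses pairs inside the unexplored part. The outcome of
-- the round is thus independent of the later run from any fixed next state, and the one-round
-- failure bounds add up.
theorem measureReal_run_le (p : unitInterval) (Good : ℕ → Exploration V → Prop) {ε : ℝ} {m : ℕ}
    (hWF : ∀ j s, Good j s → s.WF)
    (hstep : ∀ j < m, ∀ s, Good j s →
      (edgeMeasure V p).real {ω | ¬ Good (j + 1) (s.step (graphOfEdges ω))} ≤ ε)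
    (k j : ℕ) (hjk : j + k ≤ m) (s : Exploration V) (hs : Good j s) :
    (edgeMeasure V p).real {ω | ¬ Good (j + k) (run (graphOfEdges ω) k s)} ≤ k * ε := by
  induction k generalizing j s with
  | zero => simp [run, hs]
  | succ k ih =>
    set μ := edgeMeasure V p
    let I : Finset (Exploration V) :=
      Finset.univ.image fun ω : Sym2 V → Prop => s.step (graphOfEdges ω)
    have hwf := hWF j s hs
    have hsplit : μ.real {ω | ¬ Good (j + (k + 1)) (run (graphOfEdges ω) (k + 1) s)} ≤
        ∑ s' ∈ I, μ.real {ω | s.step (graphOfEdges ω) = s' ∧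
          ¬ Good (j + (k + 1)) (run (graphOfEdges ω) k s')} := by
      refine le_trans (measureReal_mono ?_ (measure_ne_top _ _)) (measureReal_biUnion_finset_le I _)
      intro ω hω
      simp only [Set.mem_iUnion]
      exact ⟨s.step (graphOfEdges ω), Finset.mem_image_of_mem _ (Finset.mem_univ ω), rfl, hω⟩
    have hstep_sum : ∀ Q : Exploration V → Prop,
        ∑ s' ∈ I, μ.real {ω | s.step (graphOfEdges ω) = s' ∧ Q s'} = μ.real {ω | Q (s.step (graphOfEdges ω))} := by
      intro Q
      rw [← measureReal_biUnion_finset]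
      · congr 1
        ext ω
        simp only [Set.mem_iUnion, I]
        constructor
        · rintro ⟨s', -, rfl, h2⟩
          exact h2
        · intro h
          exact ⟨_, Finset.mem_image_of_mem _ (Finset.mem_univ ω), rfl, h⟩
      · intro a _ b _ hab
        refine Set.disjoint_left.mpr ?_
        rintro ω ⟨h1, -⟩ ⟨h2, -⟩
        exact hab (h1.symm.trans h2)
      · exact fun _ _ => .of_discrete
    -- A bad next state is charged to the first term, a good one to the induction hypothesis. The
    -- dummy conjunct `True` lets `hstep_sum` also evaluate the total probability of the next
    -- states.
    have hterm : ∀ s' ∈ I, μ.real {ω | s.step (graphOfEdges ω) = s' ∧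
          ¬ Good (j + (k + 1)) (run (graphOfEdges ω) k s')} ≤
        μ.real {ω | s.step (graphOfEdges ω) = s' ∧ ¬ Good (j + 1) s'} +
          μ.real {ω | s.step (graphOfEdges ω) = s' ∧ True} * (k * ε) := by
      intro s' hs'
      by_cases hg : Good (j + 1) s'
      · have hind : μ.real {ω | s.step (graphOfEdges ω) = s' ∧
            ¬ Good (j + (k + 1)) (run (graphOfEdges ω) k s')} =
            μ.real {ω | s.step (graphOfEdges ω) = s'} *
              μ.real {ω | ¬ Good (j + (k + 1)) (run (graphOfEdges ω) k s')} := by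
          refine measureReal_and_of_dependsOn (iIndepFun_edgeMeasure (V := V) p)
            (S := s.unexplored.biUnion fun z => starEdges z (s.frontier ∪ s.rival))
            (T := s.unexplored.biUnion fun z => starEdges z s.unexplored) ?_ ?_ ?_
          · simp only [Finset.disjoint_left, Finset.mem_biUnion, starEdges, Finset.mem_image]
            rintro _ ⟨x, hx, a, ha, rfl⟩ ⟨y, hy, b, hb, he⟩
            -- A pair common to both edge sets would put an active vertex into the unexplored part;
            -- well-formedness of the state forbids this.
            have haU : a ∈ s.unexplored := by
              rcases Sym2.eq_iff.mp he with ⟨-, rfl⟩ | ⟨rfl, -⟩ <;> assumption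
            rcases Finset.mem_union.mp ha with ha | ha
            exacts [hwf.notMem_frontier haU ha, hwf.notMem_rival haU ha]
          · intro ω ω' h
            have : s.step (graphOfEdges ω) = s.step (graphOfEdges ω') := by
              refine step_congr fun x hx y hy => adj_congr_of_mem (h _ ?_)
              simp only [Finset.coe_biUnion, Set.mem_iUnion]
              exact ⟨x, hx, mem_starEdges (Finset.mem_union.mpr hy)⟩
            simp only [this]
          · intro ω ω' h
            obtain ⟨ω₀, -, rfl⟩ := Finset.mem_image.mp hs'
            have : run (graphOfEdges ω) k (s.step (graphOfEdges ω₀)) =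
                run (graphOfEdges ω') k (s.step (graphOfEdges ω₀)) := by
              refine run_congr k fun x hx y hy => adj_congr_of_mem (h _ ?_)
              simp only [Finset.coe_biUnion, Set.mem_iUnion]
              refine ⟨x, step_unexplored_subset _ _ hx, mem_starEdges ?_⟩
              rcases hy with hy | hy | hy
              exacts [step_unexplored_subset _ _ hy, step_frontier_subset _ _ hy,
                step_rival_subset _ _ hy]
            simp only [this]
        have hrec := ih (j + 1) (by omega) s' hg
        rw [show j + 1 + k = j + (k + 1) by omega] at hrec
        rw [hind]
        simp only [hg, not_true_eq_false, and_false, and_true, Set.ofPred_false,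
          measureReal_empty, zero_add]
        gcongr
      · have h0 : 0 ≤ k * ε := by
          rcases Nat.eq_zero_or_pos k with rfl | hk
          · simp
          · exact mul_nonneg (Nat.cast_nonneg _)
              (measureReal_nonneg.trans (hstep j (by omega) s hs))
        refine le_trans ?_ (le_add_of_nonneg_right (mul_nonneg measureReal_nonneg h0))
        exact measureReal_mono fun ω hω => ⟨hω.1, hg⟩
    calc _ ≤ _ := hsplit
      _ ≤ _ := Finset.sum_le_sum hterm
      _ = μ.real {ω | ¬ Good (j + 1) (s.step (graphOfEdges ω))} + k * ε := by
        rw [Finset.sum_add_distrib, ← Finset.sum_mul, hstep_sum (fun s' => ¬ Good (j + 1) s'),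
          hstep_sum (fun _ => True)]
        simp
      _ ≤ ε + k * ε := by gcongr; exact hstep j (by omega) s hs
      _ = _ := by push_cast; ring

end Exploration

end ExplorationProbability

/-! ### Typical growth of the layers up to distance `i`, and the last round. -/

section GrowthBounds

open MeasureTheory ProbabilityTheory

/-- Accumulated relative error from random fluctuations after `j` rounds. -/
noncomputable def fluctuation (η : ℝ) (j : ℕ) : ℝ := 2 * η * (1 - (1 / 2) ^ j)

theorem fluctuation_succ (η : ℝ) (j : ℕ) :
    fluctuation η (j + 1) = fluctuation η j + η * (1 / 2) ^ j := by
  simp only [fluctuation, pow_succ]; ring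

theorem fluctuation_nonneg {η : ℝ} (hη : 0 ≤ η) (j : ℕ) : 0 ≤ fluctuation η j := by
  have : ((1 : ℝ) / 2) ^ j ≤ 1 := pow_le_one₀ (by norm_num) (by norm_num)
  exact mul_nonneg (by positivity) (by linarith)

theorem fluctuation_le {η : ℝ} (hη : 0 ≤ η) (j : ℕ) : fluctuation η j ≤ 2 * η := by
  have : (0 : ℝ) ≤ (1 / 2) ^ j := by positivity
  unfold fluctuation
  nlinarith

/-- Lower threshold for the frontier after `j` of `i` rounds. -/
noncomputable def lowerSize (d η κ : ℝ) (i j : ℕ) : ℝ :=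
  d ^ j * (1 - fluctuation η j - 28 * (κ * 2 ^ j / 2 ^ i))

/-- Upper threshold for the frontier after `j` rounds. -/
noncomputable def upperSize (d η : ℝ) (j : ℕ) : ℝ := d ^ j * Real.exp (fluctuation η j)

/-- The sizes of the parts of the state after `j` of `i` rounds are typical. -/
structure TypicalSizes {V : Type*} (n : ℕ) (d η κ : ℝ) (i j : ℕ) (s : Exploration V) : Prop where
  wf : s.WF
  lower : lowerSize d η κ i j ≤ s.frontier.card
  upper : (s.frontier.card : ℝ) ≤ upperSize d η j
  rival : (s.rival.card : ℝ) ≤ upperSize d η j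
  unexplored_ge : (n : ℝ) - 8 * d ^ j ≤ s.unexplored.card
  unexplored_le : (s.unexplored.card : ℝ) ≤ n - 1

theorem upperSize_le {d η : ℝ} (hd : 0 ≤ d) (hη : 0 ≤ η) (hη' : η ≤ 1 / 8) (j : ℕ) :
    upperSize d η j ≤ 2 * d ^ j := by
  have h1 : Real.exp (fluctuation η j) ≤ 2 := by
    have h := fluctuation_le hη j
    have h0 := fluctuation_nonneg hη j
    have := Real.abs_exp_sub_one_sub_id_le (x := fluctuation η j)
      (by rw [abs_le]; constructor <;> linarith)
    have := (abs_le.mp this).2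
    nlinarith
  unfold upperSize
  nlinarith [pow_nonneg hd j]

theorem le_upperSize {d η : ℝ} (hd : 0 ≤ d) (hη : 0 ≤ η) (j : ℕ) : d ^ j ≤ upperSize d η j :=
  le_mul_of_one_le_right (pow_nonneg hd j) (Real.one_le_exp (fluctuation_nonneg hη j))

theorem upperSize_succ {d η : ℝ} (hd : 0 ≤ d) (j : ℕ) :
    (1 + η * (1 / 2) ^ j) * (d * upperSize d η j) ≤ upperSize d η (j + 1) := by
  unfold upperSize
  rw [fluctuation_succ, Real.exp_add, pow_succ]
  have := Real.add_one_le_exp (η * (1 / 2) ^ j)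
  have h : 0 ≤ d ^ j * d * Real.exp (fluctuation η j) := by positivity
  nlinarith [mul_le_mul_of_nonneg_left this h]

theorem lowerSize_le {d η κ : ℝ} (hd : 0 ≤ d) (hη : 0 ≤ η) (hκ : 0 ≤ κ) (i j : ℕ) :
    lowerSize d η κ i j ≤ d ^ j := by
  have h : 0 ≤ κ * 2 ^ j / 2 ^ i := by positivity
  exact mul_le_of_le_one_right (pow_nonneg hd j) (by linarith [fluctuation_nonneg hη j])

theorem lowerSize_ge {d η κ : ℝ} (hd : 0 ≤ d) (hη : 0 ≤ η) (hκ : 0 ≤ κ) {i j : ℕ} (hj : j ≤ i) :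
    d ^ j * (1 - 2 * η - 28 * κ) ≤ lowerSize d η κ i j := by
  have h : κ * 2 ^ j / 2 ^ i ≤ κ := by
    rw [div_le_iff₀ (by positivity)]
    exact mul_le_mul_of_nonneg_left (pow_le_pow_right₀ (by norm_num) hj) hκ
  exact mul_le_mul_of_nonneg_left (by linarith [fluctuation_le hη j]) (pow_nonneg hd j)

/-- With `x = κ 2 ^ j / 2 ^ i`, a round loses relative fluctuation `η 2⁻ʲ` and relative depletion
`28 x`. The allowance for depletion doubles from `28 x` to `56 x`, which is exactly enough room for
the new loss. -/
theorem lowerSize_succ {d η κ : ℝ} (hd : 0 ≤ d) (hη : 0 ≤ η) (hκ : 0 ≤ κ) {i j : ℕ}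
    (hj : j ≤ i) (hsmall : 2 * η + 28 * κ ≤ 1) :
    lowerSize d η κ i (j + 1) ≤
      (1 - η * (1 / 2) ^ j) * (d * lowerSize d η κ i j * (1 - 28 * (κ * 2 ^ j / 2 ^ i))) := by
  have h : κ * 2 ^ j / 2 ^ i ≤ κ := by
    rw [div_le_iff₀ (by positivity)]
    exact mul_le_mul_of_nonneg_left (pow_le_pow_right₀ (by norm_num) hj) hκ
  unfold lowerSize
  rw [fluctuation_succ]
  set x := κ * 2 ^ j / 2 ^ i with hx
  have hx' : κ * 2 ^ (j + 1) / 2 ^ i = 2 * x := by rw [hx, pow_succ]; ring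
  rw [hx', pow_succ]
  have hx0 : 0 ≤ x := by positivity
  have hf := fluctuation_nonneg hη j
  have hf' := fluctuation_le hη j
  set f := fluctuation η j
  set t := η * (1 / 2) ^ j
  have ht : 0 ≤ t := by positivity
  have hdd : 0 ≤ d ^ j * d := by positivity
  have h1 : 1 - (f + t) - 28 * (2 * x) ≤ (1 - f - 28 * x) * (1 - (t + 28 * x)) := by
    nlinarith [mul_nonneg (by linarith : 0 ≤ f + 28 * x) (by linarith : 0 ≤ t + 28 * x)]
  have h2 : (1 - f - 28 * x) * (1 - (t + 28 * x)) ≤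
      (1 - f - 28 * x) * ((1 - t) * (1 - 28 * x)) :=
    mul_le_mul_of_nonneg_left (by nlinarith [mul_nonneg ht hx0]) (by linarith)
  calc _ ≤ d ^ j * d * ((1 - f - 28 * x) * ((1 - t) * (1 - 28 * x))) :=
        mul_le_mul_of_nonneg_left (h1.trans h2) hdd
    _ = _ := by ring

/-- Standing numerical assumptions on the growth of neighbourhoods up to distance `i`. -/
structure GrowthRegime (n : ℕ) (p : unitInterval) (d η κ L : ℝ) (i : ℕ) : Prop where
  two_le : 2 ≤ n
  degree : d = p * ((n : ℝ) - 1)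
  four_le : 4 ≤ d
  η_nonneg : 0 ≤ η
  η_le : η ≤ 1 / 8
  κ_eq : κ = d ^ i / n
  κ_le : κ ≤ 1 / 112
  L_le : 64 * L ≤ η ^ 2 * d

namespace GrowthRegime

variable {n : ℕ} {p : unitInterval} {d η κ L : ℝ} {i : ℕ}

theorem n_pos (h : GrowthRegime n p d η κ L i) : (2 : ℝ) ≤ n := by exact_mod_cast h.two_le

theorem κ_nonneg (h : GrowthRegime n p d η κ L i) : 0 ≤ κ := by
  have := h.four_le
  rw [h.κ_eq]; positivity

/-- Going back from level `i`, the powers of `d` shrink at least as fast as powers of `2`. This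
dominates the depletion by a geometric sequence ending at `κ`, so that no factor `i` is lost in the
total error. -/
theorem pow_succ_le (h : GrowthRegime n p d η κ L i) {j : ℕ} (hj : j < i) :
    d ^ (j + 1) ≤ 2 * (κ * 2 ^ j / 2 ^ i) * n := by
  have hd := h.four_le
  have hn := h.n_pos
  have e : d ^ i = d ^ (j + 1) * d ^ (i - (j + 1)) := by rw [← pow_add]; congr 1; omega
  have e2 : (2 : ℝ) ^ i = 2 ^ (j + 1) * 2 ^ (i - (j + 1)) := by rw [← pow_add]; congr 1; omega
  have h1 : (2 : ℝ) ^ (i - (j + 1)) ≤ d ^ (i - (j + 1)) :=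
    pow_le_pow_left₀ (by norm_num) (by linarith) _
  have h2 : 2 * (κ * 2 ^ j / 2 ^ i) * n =
      d ^ (j + 1) * (d ^ (i - (j + 1)) / 2 ^ (i - (j + 1))) := by
    rw [h.κ_eq, e, e2, pow_succ 2 j]; field_simp
  rw [h2]
  exact le_mul_of_one_le_right (by positivity) ((one_le_div (by positivity)).mpr h1)

theorem edge_mul_pow_le (h : GrowthRegime n p d η κ L i) {j : ℕ} (hj : j < i) :
    p * d ^ j ≤ 4 * (κ * 2 ^ j / 2 ^ i) := by
  have hn := h.n_pos
  have h1 := h.pow_succ_le hj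
  have hx : 0 ≤ κ * 2 ^ j / 2 ^ i := by have := h.κ_nonneg; positivity
  set x := κ * 2 ^ j / 2 ^ i
  have e : d ^ (j + 1) = p * d ^ j * (n - 1) := by rw [pow_succ, h.degree]; ring
  by_contra hcon
  push Not at hcon
  nlinarith [mul_lt_mul_of_pos_right hcon (by linarith : (0 : ℝ) < n - 1)]

theorem typicalSizes_step (h : GrowthRegime n p d η κ L i) {j : ℕ} (hj : j < i)
    {s : Exploration (Fin n)} (hs : TypicalSizes n d η κ i j s) {G : SimpleGraph (Fin n)}
    (h1 : (1 - η * (1 / 2) ^ j) * (d * lowerSize d η κ i j * (1 - 28 * (κ * 2 ^ j / 2 ^ i))) ≤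
      (s.newFrontier G).card)
    (h2 : (s.newFrontier G).card ≤ (1 + η * (1 / 2) ^ j) * (d * upperSize d η j))
    (h3 : (s.newRival G).card ≤ (1 + η * (1 / 2) ^ j) * (d * upperSize d η j)) :
    TypicalSizes n d η κ i (j + 1) (s.step G) := by
  have hd : 0 ≤ d := by linarith [h.four_le]
  have h2' := h2.trans (upperSize_succ hd j)
  have h3' := h3.trans (upperSize_succ hd j)
  refine ⟨Exploration.WF.step G, ?_, h2', h3', ?_, ?_⟩
  · exact (lowerSize_succ hd h.η_nonneg h.κ_nonneg hj.le
      (by linarith [h.η_le, h.κ_le])).trans h1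
  · have hU : (s.unexplored.card : ℝ) ≤ (s.step G).unexplored.card +
        (s.newFrontier G).card + (s.newRival G).card := by
      exact_mod_cast Exploration.card_unexplored_le G s
    have hub := upperSize_le hd h.η_nonneg h.η_le (j + 1)
    have := hs.unexplored_ge
    -- The two new layers have total size at most `4 d ^ (j + 1)`, and `8 d ^ j ≤ 4 d ^ (j + 1)`;
    -- hence the constant `8` reproduces itself.
    have : 2 * d ^ j ≤ d ^ (j + 1) := by
      rw [pow_succ]; nlinarith [h.four_le, pow_nonneg hd j]
    linarith
  · refine le_trans ?_ hs.unexplored_le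
    exact_mod_cast Finset.card_le_card (Exploration.step_unexplored_subset _ _)

/-- Three Chernoff bounds: the new frontier from below and from above, and the new rival set from
above. The tolerance `t = η 2⁻ʲ` is summable, yet `t² d ^ (j + 1) = η² d (d / 4) ^ j` never drops
below `η² d ≥ 64 L`, which gives the exponent `4 L` in every round. -/
theorem measureReal_step_le (h : GrowthRegime n p d η κ L i) {j : ℕ} (hj : j < i)
    (s : Exploration (Fin n)) (hs : TypicalSizes n d η κ i j s) :
    (edgeMeasure (Fin n) p).real
      {ω | ¬ TypicalSizes n d η κ i (j + 1) (s.step (graphOfEdges ω))} ≤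
      3 * Real.exp (-(4 * L)) := by
  have hd := h.four_le
  have hη := h.η_nonneg
  have hη' := h.η_le
  have hκ := h.κ_nonneg
  have hκ' := h.κ_le
  have hn := h.n_pos
  have hp0 : 0 ≤ (p : ℝ) := p.2.1
  have hp1 : (p : ℝ) ≤ 1 := p.2.2
  set x := κ * 2 ^ j / 2 ^ i with hxdef
  have hx0 : 0 ≤ x := by positivity
  have hxκ : x ≤ κ := by
    rw [hxdef, div_le_iff₀ (by positivity)]
    exact mul_le_mul_of_nonneg_left (pow_le_pow_right₀ (by norm_num) hj.le) hκ
  have hdj : 0 < d ^ j := by positivity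
  set t := η * (1 / 2) ^ j with htdef
  have ht0 : 0 ≤ t := by positivity
  have ht1 : t ≤ 1 := by
    have : ((1 : ℝ) / 2) ^ j ≤ 1 := pow_le_one₀ (by norm_num) (by norm_num)
    nlinarith
  set a := lowerSize d η κ i j with hadef
  set b := upperSize d η j with hbdef
  have ha1 : a ≤ d ^ j := lowerSize_le (by linarith) hη hκ i j
  have ha2 : d ^ j / 2 ≤ a := by
    refine le_trans ?_ (lowerSize_ge (by linarith) hη hκ hj.le)
    nlinarith
  have hb1 : b ≤ 2 * d ^ j := upperSize_le (by linarith) hη hη' j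
  have hb2 : d ^ j ≤ b := le_upperSize (by linarith) hη j
  have hpd := h.edge_mul_pow_le hj
  have hds := h.pow_succ_le hj
  rw [← hxdef] at hpd hds
  set M := d * a * (1 - 28 * x) with hM
  have hexp : ∀ K : ℝ, d ^ (j + 1) / 4 ≤ K → Real.exp (-(t ^ 2 * K / 4)) ≤ Real.exp (-(4 * L)) := by
    intro K hK
    refine Real.exp_le_exp.mpr (neg_le_neg ?_)
    have h1 : t ^ 2 * d ^ (j + 1) = η ^ 2 * d * (d / 4) ^ j := by
      have h4 : (((1 : ℝ) / 2) ^ j) ^ 2 = (1 / 4) ^ j := by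
        rw [← pow_mul, mul_comm, pow_mul]; norm_num
      rw [htdef, mul_pow, h4, pow_succ, div_eq_mul_one_div d 4, mul_pow]; ring
    have h2 : 1 ≤ (d / 4) ^ j := one_le_pow₀ (by linarith)
    have h3 : η ^ 2 * d ≤ η ^ 2 * d * (d / 4) ^ j := le_mul_of_one_le_right (by positivity) h2
    have h4 := mul_le_mul_of_nonneg_left hK (sq_nonneg t)
    have := h.L_le
    nlinarith
  have hpow_mul : ∀ k : ℕ, 1 - (p : ℝ) * k ≤ (1 - (p : ℝ)) ^ k := fun k => by
    linarith [one_sub_one_sub_pow_le p k]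
  have hpos_a : 0 < a := by linarith
  have hMle : M ≤ s.unexplored.card *
      ((1 - (1 - (p : ℝ)) ^ s.frontier.card) * (1 - (p : ℝ)) ^ s.rival.card) := by
    have e1 : (n - 1 : ℝ) * (1 - 16 * x) ≤ s.unexplored.card := by
      refine le_trans ?_ hs.unexplored_ge
      have : 4 * d ^ j ≤ d ^ (j + 1) := by rw [pow_succ]; nlinarith
      nlinarith [mul_nonneg hx0 (by linarith : (0 : ℝ) ≤ n - 2)]
    have hpa : p * a ≤ 4 * x := (mul_le_mul_of_nonneg_left ha1 hp0).trans hpd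
    have e2 : p * a * (1 - 4 * x) ≤ 1 - (1 - (p : ℝ)) ^ s.frontier.card := by
      have f1 : (1 - (p : ℝ)) ^ s.frontier.card ≤ Real.exp (-(p * a)) := by
        exact (one_sub_pow_le_exp p _).trans
          (Real.exp_le_exp.mpr (neg_le_neg (mul_le_mul_of_nonneg_left hs.lower hp0)))
      have f0 : 0 ≤ p * a := by positivity
      have f2 := (abs_le.mp (Real.abs_exp_sub_one_sub_id_le (x := -(p * a))
        (by rw [abs_le]; constructor <;> linarith))).2
      nlinarith
    have e3 : 1 - 8 * x ≤ (1 - (p : ℝ)) ^ s.rival.card := by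
      refine le_trans ?_ (hpow_mul s.rival.card)
      have := mul_le_mul_of_nonneg_left (hs.rival.trans hb1) hp0
      nlinarith
    calc M = (n - 1) * (p * a) * (1 - 28 * x) := by rw [hM, h.degree]; ring
      -- The constant is `28 = 16 + 4 + 8`: vertices already explored, second-order loss in the
      -- probability of meeting the frontier, and contact with the rival set.
      _ ≤ (n - 1) * (p * a) * ((1 - 16 * x) * (1 - 4 * x) * (1 - 8 * x)) := by
        refine mul_le_mul_of_nonneg_left ?_ (mul_nonneg (by linarith) (by positivity))
        nlinarith [mul_nonneg hx0 hx0, mul_nonneg (mul_nonneg hx0 hx0) (by linarith : 0 ≤ 1 - x)]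
      _ = ((n - 1) * (1 - 16 * x)) * ((p * a * (1 - 4 * x)) * (1 - 8 * x)) := by ring
      _ ≤ _ := by
        have g1 : 0 ≤ 1 - 8 * x := by linarith
        have g2 : 0 ≤ p * a * (1 - 4 * x) := mul_nonneg (by positivity) (by linarith)
        exact mul_le_mul e1 (mul_le_mul e2 e3 g1 (g2.trans e2)) (mul_nonneg g2 g1)
          (Nat.cast_nonneg _)
  have hupper : ∀ k : ℕ, (k : ℝ) ≤ b → s.unexplored.card * (p * k : ℝ) ≤ d * b := by
    intro k hk
    calc (s.unexplored.card : ℝ) * (p * k) ≤ (n - 1) * (p * b) :=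
          mul_le_mul hs.unexplored_le (mul_le_mul_of_nonneg_left hk hp0) (by positivity)
            (by linarith)
      -- The bound `n - 1` on the unexplored part makes this equal to `d b` with no error term.
      _ = d * b := by rw [h.degree]; ring
  have hP1 := (Exploration.measureReal_card_newFrontier_le p hs.wf hMle ht0 ht1).trans
    (hexp M (by
      rw [hM, pow_succ]
      nlinarith [mul_le_mul ha2 (by linarith : (1 : ℝ) / 2 ≤ 1 - 28 * x) (by norm_num) hpos_a.le]))
  have hdb : d ^ (j + 1) / 4 ≤ d * b := by rw [pow_succ]; nlinarith
  have hP2 := (Exploration.measureReal_le_card_newFrontier p hs.wf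
    (hupper _ hs.upper) ht0 ht1).trans (hexp _ hdb)
  have hP3 := (Exploration.measureReal_le_card_newRival p hs.wf
    (hupper _ hs.rival) ht0 ht1).trans (hexp _ hdb)
  have hsub : {ω : Sym2 (Fin n) → Prop |
        ¬ TypicalSizes n d η κ i (j + 1) (s.step (graphOfEdges ω))} ⊆
      ({ω | ((s.newFrontier (graphOfEdges ω)).card : ℝ) ≤ (1 - t) * M} ∪
        {ω | (1 + t) * (d * b) ≤ (s.newFrontier (graphOfEdges ω)).card}) ∪
        {ω | (1 + t) * (d * b) ≤ (s.newRival (graphOfEdges ω)).card} := by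
    intro ω hω
    by_contra hcon
    simp only [Set.mem_union, Set.mem_ofPred_eq, not_or, not_le] at hcon
    obtain ⟨⟨c1, c2⟩, c3⟩ := hcon
    exact hω (h.typicalSizes_step hj hs c1.le c2.le c3.le)
  calc _ ≤ _ := measureReal_mono hsub (measure_ne_top _ _)
    _ ≤ _ := (measureReal_union_le _ _).trans (add_le_add_left (measureReal_union_le _ _) _)
    _ ≤ _ := by linarith

/-- In round `i + 1` the product `p d ^ i` is about `c` and need not be small, so the probabilities
can no longer be linearised. They are kept as exponentials, using `1 - p ≥ e^{-p/(1-p)}` for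
avoidance of the rival set. -/
theorem measureReal_last_step_le (h : GrowthRegime n p d η κ L i) (hp : (p : ℝ) < 1)
    {M t : ℝ}
    (hM : M ≤ (n - 8 * d ^ i) * (1 - Real.exp (-(p * lowerSize d η κ i i))) *
      Real.exp (-(p * upperSize d η i / (1 - p))))
    (ht0 : 0 ≤ t) (ht1 : t ≤ 1) (hexp : 4 * L ≤ t ^ 2 * M / 4)
    (s : Exploration (Fin n)) (hs : TypicalSizes n d η κ i i s) :
    (edgeMeasure (Fin n) p).real
      {ω | ¬ ((1 - t) * M ≤ (s.step (graphOfEdges ω)).frontier.card)} ≤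
      3 * Real.exp (-(4 * L)) := by
  have hp0 : 0 ≤ (p : ℝ) := p.2.1
  have hd := h.four_le
  have hn := h.n_pos
  have hMle : M ≤ s.unexplored.card *
      ((1 - (1 - (p : ℝ)) ^ s.frontier.card) * (1 - (p : ℝ)) ^ s.rival.card) := by
    have e2 : 1 - Real.exp (-(p * lowerSize d η κ i i)) ≤
        1 - (1 - (p : ℝ)) ^ s.frontier.card := by
      refine sub_le_sub_left ?_ 1
      exact (one_sub_pow_le_exp p _).trans
        (Real.exp_le_exp.mpr (neg_le_neg (mul_le_mul_of_nonneg_left hs.lower hp0)))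
    have e3 : Real.exp (-(p * upperSize d η i / (1 - p))) ≤ (1 - (p : ℝ)) ^ s.rival.card := by
      have hq : 0 < 1 - (p : ℝ) := by linarith
      have f1 : Real.exp (-(p / (1 - p))) ≤ 1 - p := by
        have g := Real.add_one_le_exp ((p : ℝ) / (1 - p))
        have e : (p : ℝ) / (1 - p) + 1 = (1 - (p : ℝ))⁻¹ := by field_simp; ring
        rw [Real.exp_neg, inv_le_comm₀ (Real.exp_pos _) hq, ← e]
        exact g
      calc _ ≤ Real.exp (-(p * s.rival.card / (1 - p))) := by
            refine Real.exp_le_exp.mpr (neg_le_neg ?_)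
            have := hs.rival
            gcongr
        _ = Real.exp (-(p / (1 - p))) ^ s.rival.card := by
            rw [← Real.exp_nat_mul]; ring_nf
        _ ≤ _ := pow_le_pow_left₀ (Real.exp_nonneg _) f1 _
    have hκn : d ^ i = κ * n := by rw [h.κ_eq]; field_simp
    have g0 : 0 ≤ (n : ℝ) - 8 * d ^ i := by rw [hκn]; nlinarith [h.κ_le]
    have g1 : 0 ≤ lowerSize d η κ i i := by
      refine le_trans ?_ (lowerSize_ge (by linarith) h.η_nonneg h.κ_nonneg le_rfl)
      exact mul_nonneg (by positivity) (by linarith [h.η_le, h.κ_le])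
    have g2 : 0 ≤ 1 - Real.exp (-(p * lowerSize d η κ i i)) := by
      have : Real.exp (-(p * lowerSize d η κ i i)) ≤ 1 :=
        Real.exp_le_one_iff.mpr (neg_nonpos.mpr (mul_nonneg hp0 g1))
      linarith
    refine hM.trans ?_
    rw [mul_assoc]
    exact mul_le_mul hs.unexplored_ge (mul_le_mul e2 e3 (Real.exp_nonneg _) (g2.trans e2))
      (mul_nonneg g2 (Real.exp_nonneg _)) (Nat.cast_nonneg _)
  have h1 := Exploration.measureReal_card_newFrontier_le p hs.wf hMle ht0 ht1
  calc _ ≤ (edgeMeasure (Fin n) p).real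
        {ω | ((s.newFrontier (graphOfEdges ω)).card : ℝ) ≤ (1 - t) * M} := by
        refine measureReal_mono fun ω hω => ?_
        exact (not_le.mp hω).le
    _ ≤ Real.exp (-(t ^ 2 * M / 4)) := h1
    _ ≤ Real.exp (-(4 * L)) := Real.exp_le_exp.mpr (neg_le_neg hexp)
    _ ≤ _ := by linarith [Real.exp_pos (-(4 * L))]

theorem typicalSizes_start (h : GrowthRegime n p d η κ L i) {v w : Fin n} (hvw : v ≠ w) :
    TypicalSizes n d η κ i 0 (Exploration.start v w) := by
  classical
  have hκ := h.κ_nonneg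
  have hU : (Exploration.start v w).unexplored.card = n - 2 := by
    have : (Exploration.start v w).unexplored = Finset.univ \ {v, w} := by
      unfold Exploration.start; congr!
    rw [this, Finset.card_sdiff_of_subset (Finset.subset_univ _), Finset.card_pair hvw]
    simp
  have hU' : ((Exploration.start v w).unexplored.card : ℝ) = n - 2 := by
    rw [hU, Nat.cast_sub h.two_le]; norm_num
  refine ⟨Exploration.wf_start hvw, ?_, ?_, ?_, ?_, ?_⟩
  · have : 0 ≤ κ * 2 ^ 0 / 2 ^ i := by positivity
    simp only [lowerSize, Exploration.start, fluctuation, Finset.card_singleton, Nat.cast_one,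
      pow_zero] at this ⊢
    linarith
  · simp [upperSize, Exploration.start, fluctuation]
  · simp [upperSize, Exploration.start, fluctuation]
  · rw [hU', pow_zero]; linarith
  · rw [hU']; linarith

theorem measureReal_frontier_lt_le (h : GrowthRegime n p d η κ L i) {v w : Fin n} (hvw : v ≠ w) :
    (edgeMeasure (Fin n) p).real {ω | ¬ (lowerSize d η κ i i ≤
      (Exploration.run (graphOfEdges ω) i (Exploration.start v w)).frontier.card)} ≤
      i * (3 * Real.exp (-(4 * L))) := by
  have := Exploration.measureReal_run_le p (TypicalSizes n d η κ i) (m := i)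
    (fun _ _ hs => hs.wf) (fun j hj s hs => h.measureReal_step_le hj s hs) i 0 (by omega) _
    (h.typicalSizes_start hvw)
  rw [Nat.zero_add] at this
  refine le_trans (measureReal_mono (fun ω hω => ?_) (measure_ne_top _ _)) this
  exact fun hs => hω hs.lower

theorem measureReal_last_frontier_lt_le (h : GrowthRegime n p d η κ L i) (hp : (p : ℝ) < 1)
    {M t : ℝ}
    (hM : M ≤ (n - 8 * d ^ i) * (1 - Real.exp (-(p * lowerSize d η κ i i))) *
      Real.exp (-(p * upperSize d η i / (1 - p))))
    (ht0 : 0 ≤ t) (ht1 : t ≤ 1) (hexp : 4 * L ≤ t ^ 2 * M / 4) {v w : Fin n} (hvw : v ≠ w) :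
    (edgeMeasure (Fin n) p).real {ω | ¬ ((1 - t) * M ≤
      (Exploration.run (graphOfEdges ω) (i + 1) (Exploration.start v w)).frontier.card)} ≤
      (i + 1) * (3 * Real.exp (-(4 * L))) := by
  have := Exploration.measureReal_run_le p
    -- After round `i + 1` only the size of the frontier matters, so the typical-size condition is
    -- replaced there by the single lower bound.
    (fun j (s : Exploration (Fin n)) => if j ≤ i then TypicalSizes n d η κ i j s
      else s.WF ∧ (1 - t) * M ≤ s.frontier.card) (ε := 3 * Real.exp (-(4 * L))) (m := i + 1)
    (fun j s hs => by split_ifs at hs; exacts [hs.wf, hs.1])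
    (fun j hj s hs => by
      rw [if_pos (by omega)] at hs
      rcases (Nat.lt_succ_iff.mp hj).lt_or_eq with hj | hj
      · simp only [if_pos (Nat.succ_le_of_lt hj)]
        exact h.measureReal_step_le hj s hs
      · subst hj
        simp only [add_le_iff_nonpos_right, Nat.le_zero_eq, one_ne_zero, if_false]
        refine le_trans (measureReal_mono (fun ω hω => ?_) (measure_ne_top _ _))
          (h.measureReal_last_step_le hp hM ht0 ht1 hexp s hs)
        exact fun hc => hω ⟨Exploration.WF.step _, hc⟩) (i + 1) 0 (by omega) _
    (by simpa using h.typicalSizes_start hvw)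
  push_cast at this
  refine le_trans (measureReal_mono (fun ω hω => ?_) (measure_ne_top _ _)) this
  intro hs
  rw [if_neg (by omega)] at hs
  exact hω hs.2

end GrowthRegime

end GrowthBounds

/-! ### Counting the vertices closer to one root, for fixed `n`. -/

section CloserVertices

open MeasureTheory ProbabilityTheory

/-- Convexity of `exp` between `-c` and `0`. It turns a relative error in the exponent into the same
relative error in `1 - e^{-c}`, whatever the size of `c`. -/
theorem mul_one_sub_exp_neg_le {lam c : ℝ} (h0 : 0 ≤ lam) (h1 : lam ≤ 1) :
    lam * (1 - Real.exp (-c)) ≤ 1 - Real.exp (-(lam * c)) := by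
  have := convexOn_exp.2 (Set.mem_univ (-c)) (Set.mem_univ 0) h0 (by linarith : 0 ≤ 1 - lam)
    (by ring)
  simp only [smul_eq_mul, mul_zero, add_zero, Real.exp_zero, mul_one] at this
  rw [show -(lam * c) = lam * -c by ring]
  linarith

theorem inv_one_sub_le_exp {x : ℝ} (h0 : 0 ≤ x) (h1 : x ≤ 1 / 2) :
    (1 - x)⁻¹ ≤ Real.exp (2 * x) := by
  have h : (1 - x)⁻¹ ≤ 1 + 2 * x := by
    rw [inv_le_iff_one_le_mul₀ (by linarith)]; nlinarith
  linarith [Real.add_one_le_exp (2 * x)]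

open Classical in
/-- The number of vertices strictly closer to `v` than to `w`. -/
noncomputable def closerCount {V : Type*} [Fintype V] (G : SimpleGraph V) (v w : V) : ℕ :=
  (Finset.univ.filter fun z => G.edist v z < G.edist w z).card

namespace GrowthRegime

variable {n : ℕ} {p : unitInterval} {d η κ : ℝ} {i : ℕ}

theorem edge_mul_pow_eq (h : GrowthRegime n p d η κ (Real.log n) i) {c : ℝ}
    (hc : c = d ^ (i + 1) / n) : p * d ^ i * (n - 1) = c * n := by
  have hn := h.n_pos
  have hcd : c * n = d ^ i * d := by rw [hc, pow_succ]; field_simp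
  rw [hcd, h.degree]; ring

theorem last_reach_ge (h : GrowthRegime n p d η κ (Real.log n) i) {c : ℝ}
    (hc : c = d ^ (i + 1) / n) (hcpos : 0 < c) :
    (1 - (2 * η + 28 * κ)) * (1 - Real.exp (-c)) ≤
      1 - Real.exp (-(p * lowerSize d η κ i i)) := by
  have hd := h.four_le
  have hn := h.n_pos
  have hp0 : 0 ≤ (p : ℝ) := p.2.1
  have hη := h.η_nonneg
  have hκ := h.κ_nonneg
  have := h.η_le
  have := h.κ_le
  have hpd := h.edge_mul_pow_eq hc
  have hlow := lowerSize_ge (by linarith : (0 : ℝ) ≤ d) hη hκ (le_refl i)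
  refine (mul_one_sub_exp_neg_le (by linarith) (by linarith)).trans ?_
  refine sub_le_sub_left (Real.exp_le_exp.mpr (neg_le_neg ?_)) 1
  have g : c ≤ p * d ^ i := by
    by_contra hcon
    push Not at hcon
    nlinarith
  calc (1 - (2 * η + 28 * κ)) * c ≤ (1 - (2 * η + 28 * κ)) * (p * d ^ i) :=
        mul_le_mul_of_nonneg_left g (by linarith)
    _ = p * (d ^ i * (1 - 2 * η - 28 * κ)) := by ring
    _ ≤ _ := mul_le_mul_of_nonneg_left hlow hp0

/-- An additive error in this exponent is a relative error in `e^{-c}`. The relative errors come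
from `1 / n`, `η` and `p`; after multiplication by `c ≤ log n` they must still be small, which is
hypothesis `h2`. -/
theorem last_rival_le (h : GrowthRegime n p d η κ (Real.log n) i) (hi : 1 ≤ i)
    (hp : (p : ℝ) ≤ 1 / 2) {ε c : ℝ} (hc : c = d ^ (i + 1) / n)
    (hcpos : 0 < c) (hclog : c ≤ Real.log n)
    (h2 : Real.log n * (8 * (1 / n + η + 2 * Real.log n / d)) ≤ ε / 8)
    (h2' : 4 * (1 / n + η + 2 * Real.log n / d) ≤ 1) :
    p * upperSize d η i / (1 - p) ≤ c + ε / 8 := by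
  have hd := h.four_le
  have hn := h.n_pos
  have hp0 : 0 ≤ (p : ℝ) := p.2.1
  have hη := h.η_nonneg
  have hlog : 0 ≤ Real.log n := Real.log_nonneg (by linarith)
  have hdi : d ≤ d ^ i := le_self_pow₀ (by linarith) (by omega)
  have hpd := h.edge_mul_pow_eq hc
  set r := 1 / n + η + 2 * Real.log n / d with hr
  have hr0 : 0 ≤ r := by positivity
  -- Since `i ≥ 1`, `p d ≤ p d ^ i ≤ 2 c ≤ 2 log n`.
  have hplog : (p : ℝ) ≤ 2 * Real.log n / d := by
    rw [le_div_iff₀ (by linarith)]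
    have g1 : p * d ≤ p * d ^ i := mul_le_mul_of_nonneg_left hdi hp0
    have g2 : p * d ^ i ≤ 2 * c := by
      by_contra hcon
      push Not at hcon
      nlinarith
    linarith
  have g1 : p * d ^ i = c * (1 - 1 / (n : ℝ))⁻¹ := by
    have : (n : ℝ) - 1 ≠ 0 := by linarith
    have h5 : 1 - 1 / (n : ℝ) = (n - 1) / n := by field_simp
    rw [h5, inv_div, ← mul_div_assoc, ← hpd]; field_simp
  have g2 : (1 - 1 / (n : ℝ))⁻¹ ≤ Real.exp (2 * (1 / n)) :=
    inv_one_sub_le_exp (by positivity)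
      (by rw [div_le_div_iff₀ (by linarith) (by norm_num)]; linarith)
  have g3 : (1 - (p : ℝ))⁻¹ ≤ Real.exp (2 * p) := inv_one_sub_le_exp hp0 hp
  have g4 : Real.exp (fluctuation η i) ≤ Real.exp (2 * η) :=
    Real.exp_le_exp.mpr (fluctuation_le hη i)
  calc p * upperSize d η i / (1 - p)
      = c * ((1 - 1 / (n : ℝ))⁻¹ * Real.exp (fluctuation η i) * (1 - (p : ℝ))⁻¹) := by
        rw [upperSize, ← mul_assoc, g1]; ring
    _ ≤ c * (Real.exp (2 * (1 / n)) * Real.exp (2 * η) * Real.exp (2 * p)) := by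
        have : 0 ≤ (1 - (p : ℝ))⁻¹ := inv_nonneg.mpr (by linarith)
        gcongr
    _ = c * Real.exp (2 * (1 / n) + 2 * η + 2 * p) := by rw [Real.exp_add, Real.exp_add]
    _ ≤ c * Real.exp (2 * r) := by
        refine mul_le_mul_of_nonneg_left (Real.exp_le_exp.mpr ?_) hcpos.le
        rw [hr]; linarith
    _ ≤ c * (1 + 4 * r) := by
        refine mul_le_mul_of_nonneg_left ?_ hcpos.le
        have := (abs_le.mp (Real.abs_exp_sub_one_sub_id_le (x := 2 * r)
          (by rw [abs_le]; constructor <;> linarith))).2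
        nlinarith
    _ ≤ c + ε / 8 := by nlinarith

theorem le_last_mean (h : GrowthRegime n p d η κ (Real.log n) i) (hi : 1 ≤ i)
    (hp : (p : ℝ) ≤ 1 / 2) {ε c : ℝ} (hε0 : 0 < ε) (hε1 : ε < 1) (hc : c = d ^ (i + 1) / n)
    (hcpos : 0 < c) (hclog : c ≤ Real.log n) (h1 : 2 * η + 36 * κ ≤ ε / 8)
    (h2 : Real.log n * (8 * (1 / n + η + 2 * Real.log n / d)) ≤ ε / 8)
    (h2' : 4 * (1 / n + η + 2 * Real.log n / d) ≤ 1) :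
    (1 - ε / 2) * (n * (Real.exp (-c) * (1 - Real.exp (-c)))) ≤
      (n - 8 * d ^ i) * (1 - Real.exp (-(p * lowerSize d η κ i i))) *
        Real.exp (-(p * upperSize d η i / (1 - p))) := by
  have hd := h.four_le
  have hn := h.n_pos
  have hp0 : 0 ≤ (p : ℝ) := p.2.1
  have hη := h.η_nonneg
  have hκ := h.κ_nonneg
  have hκn : d ^ i = κ * n := by rw [h.κ_eq]; field_simp
  have hec0 := Real.exp_pos (-c)
  have hec1 : Real.exp (-c) ≤ 1 := Real.exp_le_one_iff.mpr (by linarith)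
  have e1 : (n : ℝ) - 8 * d ^ i = n * (1 - 8 * κ) := by rw [hκn]; ring
  have e2 := h.last_reach_ge hc hcpos
  have e3 := h.last_rival_le hi hp hc hcpos hclog h2 h2'
  have e4 : Real.exp (-c) * (1 - ε / 8) ≤
      Real.exp (-(p * upperSize d η i / (1 - p))) := by
    calc _ ≤ Real.exp (-c) * Real.exp (-(ε / 8)) :=
          mul_le_mul_of_nonneg_left (by linarith [Real.add_one_le_exp (-(ε / 8))]) hec0.le
      _ = Real.exp (-(c + ε / 8)) := by rw [← Real.exp_add]; ring_nf
      _ ≤ _ := Real.exp_le_exp.mpr (neg_le_neg e3)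
  have g5 : 0 ≤ 1 - Real.exp (-c) := by linarith
  have g6 : 1 - ε / 2 ≤ (1 - 8 * κ) * (1 - (2 * η + 28 * κ)) * (1 - ε / 8) := by
    nlinarith [mul_nonneg hκ hη, mul_nonneg hκ hκ,
      mul_nonneg (mul_nonneg hκ (by linarith : 0 ≤ 2 * η + 28 * κ))
        (by linarith : 0 ≤ 1 - ε / 8)]
  calc _ ≤ (1 - 8 * κ) * (1 - (2 * η + 28 * κ)) * (1 - ε / 8) *
        (n * (Real.exp (-c) * (1 - Real.exp (-c)))) :=
        mul_le_mul_of_nonneg_right g6 (by positivity)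
    _ = n * (1 - 8 * κ) * ((1 - (2 * η + 28 * κ)) * (1 - Real.exp (-c))) *
        (Real.exp (-c) * (1 - ε / 8)) := by ring
    _ ≤ _ := by
        rw [e1]
        have k1 : 0 ≤ n * (1 - 8 * κ) := mul_nonneg (by linarith) (by linarith)
        have k2 : 0 ≤ (1 - (2 * η + 28 * κ)) * (1 - Real.exp (-c)) :=
          mul_nonneg (by linarith) g5
        exact mul_le_mul (mul_le_mul_of_nonneg_left e2 k1) e4
          (mul_nonneg hec0.le (by linarith)) (mul_nonneg k1 (k2.trans e2))

theorem log_le_last_mean (h : GrowthRegime n p d η κ (Real.log n) i) (hi : 1 ≤ i) {ε c c₀ : ℝ}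
    (hε0 : 0 < ε) (hε1 : ε < 1) (hc₀ : 0 < c₀) (hcc : c₀ ≤ c)
    (h4 : 4 * Real.log n ≤ ε ^ 3 / 64 * (1 - Real.exp (-c₀)) * d)
    (hcase : ε / 2 * d ^ i ≤ n * Real.exp (-c)) :
    4 * Real.log n ≤
      (ε / 2) ^ 2 * ((1 - ε / 2) * (n * (Real.exp (-c) * (1 - Real.exp (-c))))) / 4 := by
  have hd := h.four_le
  have hdi : d ≤ d ^ i := le_self_pow₀ (by linarith) (by omega)
  have hec : Real.exp (-c) ≤ Real.exp (-c₀) := Real.exp_le_exp.mpr (by linarith)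
  have hec₀ : Real.exp (-c₀) < 1 := by
    rw [← Real.exp_zero]; exact Real.exp_lt_exp.mpr (by linarith)
  have k1 : ε / 2 * d ≤ n * Real.exp (-c) :=
    le_trans (mul_le_mul_of_nonneg_left hdi (by linarith)) hcase
  have k2 : ε / 2 * d * (1 - Real.exp (-c₀)) ≤ n * Real.exp (-c) * (1 - Real.exp (-c)) :=
    mul_le_mul k1 (by linarith) (by linarith) (by positivity)
  have k3 : 0 ≤ ε / 2 * d * (1 - Real.exp (-c₀)) := mul_nonneg (by positivity) (by linarith)
  have k4 : 1 / 2 * (ε / 2 * d * (1 - Real.exp (-c₀))) ≤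
      (1 - ε / 2) * (n * Real.exp (-c) * (1 - Real.exp (-c))) :=
    mul_le_mul (by linarith) k2 k3 (by linarith)
  calc _ ≤ _ := h4
    -- The constant `ε ^ 3 / 64` in `h4` is `(ε / 2) ^ 2 / 4 · 1 / 2 · ε / 2`.
    _ = (ε / 2) ^ 2 / 4 * (1 / 2 * (ε / 2 * d * (1 - Real.exp (-c₀)))) := by ring
    _ ≤ (ε / 2) ^ 2 / 4 * ((1 - ε / 2) * (n * Real.exp (-c) * (1 - Real.exp (-c)))) :=
        mul_le_mul_of_nonneg_left k4 (by positivity)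
    _ = _ := by ring

theorem measureReal_closerCount_lt_le (h : GrowthRegime n p d η κ (Real.log n) i) (hi : 1 ≤ i)
    (hp : (p : ℝ) ≤ 1 / 2) {ε c c₀ : ℝ} (hε0 : 0 < ε) (hε1 : ε < 1) (hc : c = d ^ (i + 1) / n)
    (hc₀ : 0 < c₀) (hcc : c₀ ≤ c) (h1 : 2 * η + 36 * κ ≤ ε / 8)
    (h2 : Real.log n * (8 * (1 / n + η + 2 * Real.log n / d)) ≤ ε / 8)
    (h2' : 4 * (1 / n + η + 2 * Real.log n / d) ≤ 1)
    (h3 : 1 ≤ ε / 2 * d) (h4 : 4 * Real.log n ≤ ε ^ 3 / 64 * (1 - Real.exp (-c₀)) * d)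
    {v w : Fin n} (hvw : v ≠ w) :
    (edgeMeasure (Fin n) p).real {ω | ¬ ((1 - ε) * (d ^ i + n * (Real.exp (-c) *
      (1 - Real.exp (-c)))) ≤ closerCount (graphOfEdges ω) v w)} ≤
      6 * (i + 1) * Real.exp (-(4 * Real.log n)) := by
  have hd := h.four_le
  have hη := h.η_nonneg
  have hκ := h.κ_nonneg
  have hn := h.n_pos
  have hdi : d ≤ d ^ i := le_self_pow₀ (by linarith) (by omega)
  have hlog : 0 ≤ Real.log n := Real.log_nonneg (by linarith)
  have hec : Real.exp (-c) ≤ Real.exp (-c₀) := Real.exp_le_exp.mpr (by linarith)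
  have hec0 := Real.exp_pos (-c)
  have hec₀ : Real.exp (-c₀) < 1 := by
    rw [← Real.exp_zero]; exact Real.exp_lt_exp.mpr (by linarith)
  have hlow := lowerSize_ge (by linarith : (0 : ℝ) ≤ d) hη hκ (le_refl i)
  have hexp4 : 0 ≤ Real.exp (-(4 * Real.log n)) := (Real.exp_pos _).le
  have hcount : ∀ ω : Sym2 (Fin n) → Prop,
      ((Exploration.run (graphOfEdges ω) i (Exploration.start v w)).frontier.card : ℝ) +
      (Exploration.run (graphOfEdges ω) (i + 1) (Exploration.start v w)).frontier.card ≤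
      closerCount (graphOfEdges ω) v w := fun ω => by
    exact_mod_cast Exploration.card_frontier_add_card_frontier_le (graphOfEdges ω) hvw i
  have hP1 := h.measureReal_frontier_lt_le hvw
  -- If the last layer is negligible against `d ^ i`, layer `i` alone suffices. Otherwise `n e^{-c}
  -- ≥ ε / 2 · d ≥ 1`, so `c ≤ log n`, and the mean of the last layer is large enough for
  -- concentration.
  rcases lt_or_ge (n * Real.exp (-c)) (ε / 2 * d ^ i) with hcase | hcase
  · refine le_trans (measureReal_mono (fun ω hω => ?_) (measure_ne_top _ _)) (hP1.trans ?_)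
    · intro hA
      refine hω (le_trans ?_ (hcount ω))
      have hB : (0 : ℝ) ≤ (Exploration.run (graphOfEdges ω) (i + 1)
        (Exploration.start v w)).frontier.card := Nat.cast_nonneg _
      have g1 : d ^ i * (1 - ε / 2) ≤ lowerSize d η κ i i :=
        le_trans (mul_le_mul_of_nonneg_left (by linarith) (by linarith)) hlow
      have g2 : n * (Real.exp (-c) * (1 - Real.exp (-c))) ≤ ε / 2 * d ^ i := by
        have : n * (Real.exp (-c) * (1 - Real.exp (-c))) ≤ n * Real.exp (-c) :=
          mul_le_mul_of_nonneg_left (mul_le_of_le_one_right hec0.le (by linarith)) (by linarith)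
        linarith
      calc _ ≤ (1 - ε) * (d ^ i + ε / 2 * d ^ i) :=
            mul_le_mul_of_nonneg_left (by linarith) (by linarith)
        _ ≤ d ^ i * (1 - ε / 2) := by nlinarith [mul_nonneg hε0.le (by linarith : 0 ≤ d ^ i)]
        _ ≤ _ := by linarith
    · have : (0 : ℝ) ≤ i := Nat.cast_nonneg _
      nlinarith
  · have hclog : c ≤ Real.log n := by
      have g : (n : ℝ)⁻¹ ≤ Real.exp (-c) := by
        rw [inv_le_iff_one_le_mul₀ (by linarith)]
        have := mul_le_mul_of_nonneg_left hdi (by linarith : 0 ≤ ε / 2)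
        linarith
      have := Real.log_le_log (by positivity) g
      rw [Real.log_inv, Real.log_exp] at this
      linarith
    have hcpos : 0 < c := by linarith
    set M := (1 - ε / 2) * (n * (Real.exp (-c) * (1 - Real.exp (-c)))) with hM
    have hMle : M ≤ (n - 8 * d ^ i) * (1 - Real.exp (-(p * lowerSize d η κ i i))) *
        Real.exp (-(p * upperSize d η i / (1 - p))) :=
      h.le_last_mean hi hp hε0 hε1 hc hcpos hclog h1 h2 h2'
    have hexp : 4 * Real.log n ≤ (ε / 2) ^ 2 * M / 4 :=
      h.log_le_last_mean hi hε0 hε1 hc₀ hcc h4 hcase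
    have hP2 := h.measureReal_last_frontier_lt_le (by linarith) hMle (by linarith : 0 ≤ ε / 2)
      (by linarith) hexp hvw
    have hsub : {ω : Sym2 (Fin n) → Prop | ¬ ((1 - ε) * (d ^ i + n * (Real.exp (-c) *
        (1 - Real.exp (-c)))) ≤ closerCount (graphOfEdges ω) v w)} ⊆
        {ω | ¬ (lowerSize d η κ i i ≤ (Exploration.run (graphOfEdges ω) i
          (Exploration.start v w)).frontier.card)} ∪
        {ω | ¬ ((1 - ε / 2) * M ≤ (Exploration.run (graphOfEdges ω) (i + 1)
          (Exploration.start v w)).frontier.card)} := by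
      intro ω hω
      by_contra hcon
      simp only [Set.mem_union, Set.mem_ofPred_eq, not_or, not_not] at hcon
      refine hω (le_trans ?_ (hcount ω))
      have g1 : (1 - ε) * d ^ i ≤ lowerSize d η κ i i := by
        refine le_trans ?_ hlow
        rw [mul_comm]
        exact mul_le_mul_of_nonneg_left (by linarith) (by linarith)
      have g2 : (1 - ε) * (n * (Real.exp (-c) * (1 - Real.exp (-c)))) ≤ (1 - ε / 2) * M := by
        rw [hM, ← mul_assoc (1 - ε / 2)]
        refine mul_le_mul_of_nonneg_right (by nlinarith) ?_
        exact mul_nonneg (by linarith) (mul_nonneg hec0.le (by linarith))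
      linarith [hcon.1, hcon.2]
    have hfin := (measureReal_mono hsub (measure_ne_top _ _)).trans
      ((measureReal_union_le _ _).trans (add_le_add hP1 hP2))
    have : (0 : ℝ) ≤ i := Nat.cast_nonneg _
    exact hfin.trans (by linarith)

end GrowthRegime

end CloserVertices

/-! ### Asymptotic choice of parameters, and the union bound over pairs. -/

section AasCloser

open MeasureTheory ProbabilityTheory

theorem eventually_measureReal_closerCount_lt_le (p : ℕ → unitInterval) (d : ℕ → ℝ)
    (hd : ∀ n, d n = avgDegree p n) (hd_large : (fun n : ℕ => Real.log n ^ 3) =o[atTop] d)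
    (hp : Tendsto (fun n => (p n : ℝ)) atTop (𝓝 0)) (i : ℕ → ℕ) (hi : ∀ᶠ n in atTop, 1 ≤ i n)
    (hio : (fun n => d n ^ i n) =o[atTop] (fun n : ℕ => (n : ℝ)))
    (c : ℕ → ℝ) (hc : ∀ n, c n = d n ^ (i n + 1) / n) {c₀ : ℝ} (hc₀ : 0 < c₀)
    (hcc : ∀ᶠ n in atTop, c₀ ≤ c n) {ε : ℝ} (hε0 : 0 < ε) (hε1 : ε < 1) :
    ∀ᶠ n in atTop, i n + 1 ≤ n ∧ ∀ v w : Fin n, v ≠ w →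
      (edgeMeasure (Fin n) (p n)).real {ω | ¬ ((1 - ε) * (d n ^ i n + n * (Real.exp (-c n) *
        (1 - Real.exp (-c n)))) ≤ closerCount (graphOfEdges ω) v w)} ≤
        6 * (i n + 1) * Real.exp (-(4 * Real.log n)) := by
  have hu : Tendsto (fun n : ℕ => Real.log n ^ 3 / d n) atTop (𝓝 0) :=
    hd_large.tendsto_div_nhds_zero
  have hκ : Tendsto (fun n : ℕ => d n ^ i n / n) atTop (𝓝 0) := hio.tendsto_div_nhds_zero
  have hsq : Tendsto (fun n : ℕ => √(Real.log n ^ 3 / d n)) atTop (𝓝 0) := by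
    simpa using hu.sqrt
  have hlog : Tendsto (fun n : ℕ => Real.log n) atTop atTop :=
    Real.tendsto_log_atTop.comp tendsto_natCast_atTop_atTop
  set C := ε ^ 3 / 64 * (1 - Real.exp (-c₀)) with hC
  have hC0 : 0 < C := by
    have : Real.exp (-c₀) < 1 := by
      rw [← Real.exp_zero]; exact Real.exp_lt_exp.mpr (by linarith)
    exact mul_pos (by positivity) (by linarith)
  have hdpos : ∀ᶠ n in atTop, 0 < d n := by
    filter_upwards [hd_large.bound one_pos, hlog.eventually_ge_atTop 1, eventually_ge_atTop 1]
      with n h1 h2 h3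
    have h0 : 0 ≤ d n := by
      rw [hd, avgDegree]
      have : (1 : ℝ) ≤ n := by exact_mod_cast h3
      exact mul_nonneg (p n).2.1 (by linarith)
    rw [Real.norm_of_nonneg (by positivity), Real.norm_of_nonneg h0, one_mul] at h1
    have : (1 : ℝ) ≤ Real.log n ^ 3 := one_le_pow₀ h2
    linarith
  have s1 : ∀ δ : ℝ, 0 < δ → ∀ᶠ n : ℕ in atTop, Real.log n ^ 3 / d n < δ :=
    fun δ hδ => hu.eventually_lt_const hδ
  have s2 : ∀ δ : ℝ, 0 < δ → ∀ᶠ n : ℕ in atTop, √(Real.log n ^ 3 / d n) < δ :=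
    fun δ hδ => hsq.eventually_lt_const hδ
  filter_upwards [hdpos, hi, hcc, hlog.eventually_ge_atTop 1, eventually_ge_atTop 2,
    hp.eventually_lt_const (by norm_num : (0 : ℝ) < 1 / 2), s1 (ε / 1000) (by positivity),
    s2 (ε / 1000) (by positivity), s1 (C / 4) (by positivity),
    hκ.eventually_lt_const (by positivity : 0 < ε / 1000)]
    with n hdp hin hcn hlogn hn2 hpn hu1 hs1 hu2 hκ1
  have hn : (2 : ℝ) ≤ n := by exact_mod_cast hn2
  have hdn : d n = p n * ((n : ℝ) - 1) := hd n
  have hdle : d n ≤ n := by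
    rw [hdn]
    nlinarith [(p n).2.1, (p n).2.2]
  set u := Real.log n ^ 3 / d n with hudef
  have hl1 : Real.log n ≤ Real.log n ^ 3 := le_self_pow₀ hlogn (by norm_num)
  have hl2 : Real.log n ^ 2 ≤ Real.log n ^ 3 := pow_le_pow_right₀ hlogn (by norm_num)
  have b1 : Real.log n / d n ≤ u := div_le_div_of_nonneg_right hl1 hdp.le
  have b2 : Real.log n ^ 2 / d n ≤ u := div_le_div_of_nonneg_right hl2 hdp.le
  have b3 : 1 / d n ≤ u :=
    (div_le_div_of_nonneg_right hlogn hdp.le).trans b1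
  have b4 : Real.log n / n ≤ u :=
    (div_le_div_of_nonneg_left (by linarith) hdp hdle).trans b1
  have b5 : (1 : ℝ) / n ≤ u := (div_le_div_of_nonneg_right hlogn (by linarith)).trans b4
  have hL0 : 0 ≤ Real.log n := by linarith
  have b6 : √(Real.log n / d n) ≤ √u := Real.sqrt_le_sqrt b1
  -- This is where the cube of the logarithm is needed: `log n · η = 8 √(log³ n / d) → 0`.
  have b7 : Real.log n * √(Real.log n / d n) = √u := by
    rw [hudef, show Real.log n ^ 3 / d n = Real.log n ^ 2 * (Real.log n / d n) by ring,
      Real.sqrt_mul (by positivity), Real.sqrt_sq hL0]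
  -- The smallest `η` permitted by the growth regime, with `η² d = 64 log n`.
  set η := 8 * √(Real.log n / d n) with hη
  have hd4 : 1000 < d n := by
    have : 1 / d n < 1 / 1000 := by linarith
    rw [div_lt_iff₀ hdp] at this
    linarith
  have hη0 : 0 ≤ η := by positivity
  have h : GrowthRegime n (p n) (d n) η (d n ^ i n / n) (Real.log n) (i n) := by
    refine ⟨hn2, hdn, by linarith, hη0, by linarith, rfl, by linarith, ?_⟩
    rw [hη, mul_pow, Real.sq_sqrt (by positivity)]
    field_simp
    norm_num
  constructor
  · have h1 : (2 : ℝ) ^ i n ≤ d n ^ i n := pow_le_pow_left₀ (by norm_num) (by linarith) _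
    have h2 : d n ^ i n ≤ n := by
      rw [div_lt_iff₀ (by linarith)] at hκ1
      nlinarith
    have h3 : 2 ^ i n ≤ n := by exact_mod_cast h1.trans h2
    have := Nat.lt_two_pow_self (n := i n)
    omega
  · intro v w hvw
    have e2 : Real.log n * (1 / n + η + 2 * Real.log n / d n) =
        Real.log n / n + 8 * √u + 2 * (Real.log n ^ 2 / d n) := by
      rw [← b7, hη]; ring
    refine h.measureReal_closerCount_lt_le hin (by linarith) hε0 hε1 (hc n) hc₀ hcn
      (by linarith) ?_ ?_ ?_ ?_ hvw
    · linarith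
    · have : 2 * Real.log n / d n = 2 * (Real.log n / d n) := by ring
      linarith
    · have : 1 / d n ≤ ε / 2 := by linarith
      rw [div_le_iff₀ hdp] at this
      exact this
    · have : Real.log n / d n ≤ C / 4 := by linarith
      rw [div_le_iff₀ hdp] at this
      have h5 : 4 * Real.log n ≤ C * d n := by linarith
      exact h5

theorem holdsAas_of_measureReal_not_le {p : ℕ → unitInterval}
    {A : ∀ n : ℕ, Set (SimpleGraph (Fin n))} {b : ℕ → ℝ} (hb : Tendsto b atTop (𝓝 0))
    (h : ∀ᶠ n in atTop, (edgeMeasure (Fin n) (p n)).real {ω | ¬ graphOfEdges ω ∈ A n} ≤ b n) :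
    HoldsAas p A := by
  have h1 : Tendsto (fun n => 1 - b n) atTop (𝓝 1) := by simpa using hb.const_sub 1
  refine tendsto_of_tendsto_of_tendsto_of_le_of_le' h1 tendsto_const_nhds ?_
    (Eventually.of_forall fun n => measureReal_le_one)
  filter_upwards [h] with n hn
  have e : {ω : Sym2 (Fin n) → Prop | ¬ graphOfEdges ω ∈ A n} = {ω | graphOfEdges ω ∈ A n}ᶜ := rfl
  rw [e, probReal_compl_eq_one_sub .of_discrete] at hn
  rw [binomialRandom_real_eq]
  linarith

theorem holdsAas_le_closerCount (p : ℕ → unitInterval) (d : ℕ → ℝ)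
    (hd : ∀ n, d n = avgDegree p n) (hd_large : (fun n : ℕ => Real.log n ^ 3) =o[atTop] d)
    (hp : Tendsto (fun n => (p n : ℝ)) atTop (𝓝 0)) (i : ℕ → ℕ) (hi : ∀ᶠ n in atTop, 1 ≤ i n)
    (hio : (fun n => d n ^ i n) =o[atTop] (fun n : ℕ => (n : ℝ)))
    (c : ℕ → ℝ) (hc : ∀ n, c n = d n ^ (i n + 1) / n) {c₀ : ℝ} (hc₀ : 0 < c₀)
    (hcc : ∀ᶠ n in atTop, c₀ ≤ c n) {ε : ℝ} (hε0 : 0 < ε) (hε1 : ε < 1) :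
    HoldsAas p fun n => {G | ∀ v w : Fin n, v ≠ w →
      (1 - ε) * (d n ^ i n + n * (Real.exp (-c n) * (1 - Real.exp (-c n)))) ≤
        closerCount G v w} := by
  refine holdsAas_of_measureReal_not_le (b := fun n : ℕ => 6 * (1 / (n : ℝ))) ?_ ?_
  · simpa using tendsto_one_div_atTop_nhds_zero_nat.const_mul (6 : ℝ)
  filter_upwards [eventually_measureReal_closerCount_lt_le p d hd hd_large hp i hi hio c hc hc₀
    hcc hε0 hε1, eventually_ge_atTop 1] with n hn hn1
  have hnpos : (0 : ℝ) < n := by exact_mod_cast hn1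
  set μ := edgeMeasure (Fin n) (p n)
  set T := (1 - ε) * (d n ^ i n + n * (Real.exp (-c n) * (1 - Real.exp (-c n))))
  set b := 6 * ((i n : ℝ) + 1) * Real.exp (-(4 * Real.log n))
  have hb0 : 0 ≤ b := by positivity
  have hsub : {ω : Sym2 (Fin n) → Prop | ¬ graphOfEdges ω ∈ {G : SimpleGraph (Fin n) |
      ∀ v w : Fin n, v ≠ w → T ≤ closerCount G v w}} ⊆
      ⋃ x ∈ (Finset.univ : Finset (Fin n × Fin n)),
        {ω | x.1 ≠ x.2 ∧ ¬ (T ≤ closerCount (graphOfEdges ω) x.1 x.2)} := by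
    intro ω hω
    simp only [Set.mem_ofPred_eq, not_forall] at hω
    obtain ⟨v, w, hvw, hlt⟩ := hω
    simp only [Set.mem_iUnion]
    exact ⟨(v, w), Finset.mem_univ _, hvw, hlt⟩
  calc _ ≤ _ := measureReal_mono hsub (measure_ne_top _ _)
    _ ≤ _ := measureReal_biUnion_finset_le _ _
    _ ≤ ∑ _x ∈ (Finset.univ : Finset (Fin n × Fin n)), b := by
        refine Finset.sum_le_sum fun x _ => ?_
        by_cases hx : x.1 = x.2
        · simpa [hx] using hb0
        · refine le_trans (measureReal_mono (fun ω hω => hω.2) (measure_ne_top _ _))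
            (hn.2 x.1 x.2 hx)
    _ = n * n * b := by simp
    -- There are `n ^ 2` pairs and at most `n` rounds, against `n⁻⁴` per round; what remains is `6 /
    -- n`.
    _ ≤ n * n * (6 * n * (1 / n ^ 4)) := by
        have e : Real.exp (-(4 * Real.log n)) = 1 / (n : ℝ) ^ 4 := by
          rw [Real.exp_neg, show 4 * Real.log n = Real.log ((n : ℝ) ^ 4) by
            rw [Real.log_pow]; norm_num, Real.exp_log (by positivity), one_div]
        have e2 : (i n : ℝ) + 1 ≤ n := by exact_mod_cast hn.1
        refine mul_le_mul_of_nonneg_left ?_ (by positivity)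
        simp only [b]
        rw [e]
        gcongr
    _ = _ := by field_simp

end AasCloser

/-! ### From many separating vertices to small resolving sets. -/

section ResolvingSets

open MeasureTheory ProbabilityTheory

theorem SimpleGraph.metricDimension_le {V : Type*} {G : SimpleGraph V} {R : Finset V}
    (h : G.IsResolvingSet R) : G.metricDimension ≤ R.card :=
  Nat.sInf_le ⟨R, h, rfl⟩

theorem SimpleGraph.isResolvingSet_iff {V : Type*} {G : SimpleGraph V} {R : Finset V} :
    G.IsResolvingSet R ↔ ∀ v w, v ≠ w → ∃ z ∈ R, G.edist v z ≠ G.edist w z := by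
  refine forall_congr' fun v => forall_congr' fun w => imp_congr_right fun _ => ?_
  rw [Function.ne_iff]
  simp

open Classical in
/-- If any two vertices are separated by at least `s` vertices, then a set of `r` random vertices
is resolving with positive probability as soon as `n ^ 2 * (1 - s / n) ^ r < 1`. -/
theorem SimpleGraph.metricDimension_le_of_separators {V : Type*} [Fintype V] {G : SimpleGraph V}
    {s : ℝ} (hs : ∀ v w, v ≠ w →
      s ≤ (Finset.univ.filter fun z => G.edist v z ≠ G.edist w z).card) {r : ℕ}
    (hr : (Fintype.card V : ℝ) ^ 2 * (1 - s / Fintype.card V) ^ r < 1) :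
    G.metricDimension ≤ r := by
  rcases isEmpty_or_nonempty V with hV | hV
  · refine (SimpleGraph.metricDimension_le (R := ∅) ?_).trans (by simp)
    exact fun v => hV.elim v
  set n := Fintype.card V with hn
  have hn0 : (0 : ℝ) < n := by exact_mod_cast Fintype.card_pos
  let bad : V → V → Finset V := fun v w => Finset.univ.filter fun z => G.edist v z = G.edist w z
  have hbad : ∀ v w, v ≠ w → ((bad v w).card : ℝ) ≤ n - s := by
    intro v w hvw
    have h1 := Finset.card_filter_add_card_filter_not (s := (Finset.univ : Finset V))
      (fun z => G.edist v z = G.edist w z)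
    have h2 : ((bad v w).card : ℝ) +
        (Finset.univ.filter fun z => G.edist v z ≠ G.edist w z).card = n := by
      exact_mod_cast h1
    linarith [hs v w hvw]
  -- The `r`-tuples that miss every separator of some pair. Repetitions are allowed, so that the
  -- count is an exact `r`-th power.
  let B : Finset (Fin r → V) :=
    (Finset.univ.filter fun x : V × V => x.1 ≠ x.2).biUnion fun x =>
      Fintype.piFinset fun _ => bad x.1 x.2
  have hB : (B.card : ℝ) < (n : ℝ) ^ r := by
    have h1 : (B.card : ℝ) ≤ ∑ x ∈ (Finset.univ.filter fun x : V × V => x.1 ≠ x.2),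
        ((n : ℝ) - s) ^ r := by
      have : B.card ≤ _ := Finset.card_biUnion_le
      refine (Nat.cast_le.mpr this).trans ?_
      rw [Nat.cast_sum]
      refine Finset.sum_le_sum fun x hx => ?_
      rw [Fintype.card_piFinset]
      simp only [Finset.prod_const, Finset.card_univ, Fintype.card_fin, Nat.cast_pow]
      exact pow_le_pow_left₀ (Nat.cast_nonneg _) (hbad _ _ (Finset.mem_filter.mp hx).2) r
    -- Nonnegativity of `n - s` is read off from a pair; without a pair, `s` is unconstrained but
    -- the sum is empty.
    by_cases hne : ∃ x : V × V, x.1 ≠ x.2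
    · obtain ⟨x, hx⟩ := hne
      have hns : 0 ≤ (n : ℝ) - s := (Nat.cast_nonneg _).trans (hbad x.1 x.2 hx)
      have e : (n : ℝ) - s = n * (1 - s / n) := by field_simp
      calc (B.card : ℝ) ≤ _ := h1
        _ ≤ (n : ℝ) ^ 2 * ((n : ℝ) - s) ^ r := by
          rw [Finset.sum_const, nsmul_eq_mul]
          refine mul_le_mul_of_nonneg_right ?_ (pow_nonneg hns r)
          have : (Finset.univ.filter fun x : V × V => x.1 ≠ x.2).card ≤ n ^ 2 := by
            refine (Finset.card_filter_le _ _).trans ?_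
            simp [hn, sq]
          exact_mod_cast this
        _ = (n : ℝ) ^ r * ((n : ℝ) ^ 2 * (1 - s / n) ^ r) := by rw [e, mul_pow]; ring
        _ < (n : ℝ) ^ r * 1 := mul_lt_mul_of_pos_left hr (by positivity)
        _ = _ := mul_one _
    · push Not at hne
      have : (Finset.univ.filter fun x : V × V => x.1 ≠ x.2) = ∅ :=
        Finset.filter_eq_empty_iff.mpr fun x _ => not_not.mpr (hne x)
      rw [this, Finset.sum_empty] at h1
      exact h1.trans_lt (by positivity)
  obtain ⟨f, hf⟩ : ∃ f : Fin r → V, f ∉ B := by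
    by_contra hcon
    push Not at hcon
    have : B = Finset.univ := Finset.eq_univ_iff_forall.mpr hcon
    rw [this, Finset.card_univ, Fintype.card_fun, Fintype.card_fin] at hB
    push_cast at hB
    exact lt_irrefl _ hB
  refine (SimpleGraph.metricDimension_le (R := Finset.univ.image f) ?_).trans
    (Finset.card_image_le.trans (by simp))
  rw [SimpleGraph.isResolvingSet_iff]
  intro v w hvw
  by_contra hcon
  push Not at hcon
  refine hf (Finset.mem_biUnion.mpr ⟨(v, w), by simpa using hvw, ?_⟩)
  rw [Fintype.mem_piFinset]
  exact fun a => Finset.mem_filter.mpr ⟨Finset.mem_univ _,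
    hcon (f a) (Finset.mem_image_of_mem _ (Finset.mem_univ a))⟩

open Classical in
theorem closerCount_add_closerCount_le {V : Type*} [Fintype V] (G : SimpleGraph V) (v w : V) :
    closerCount G v w + closerCount G w v ≤
      (Finset.univ.filter fun z => G.edist v z ≠ G.edist w z).card := by
  unfold closerCount
  rw [← Finset.card_union_of_disjoint]
  · refine Finset.card_le_card fun z hz => ?_
    simp only [Finset.mem_union, Finset.mem_filter, Finset.mem_univ, true_and] at hz ⊢
    exact hz.elim ne_of_lt ne_of_gt
  · rw [Finset.disjoint_filter]
    exact fun z _ h => not_lt_of_gt h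

/-- The metric dimension is a.a.s. at most `(1 + o(1)) f` if it is a.a.s. at most `(1 + ε) f` for
every small `ε > 0`. -/
theorem metricDimensionAasLe_of_forall {p : ℕ → unitInterval} {f : ℕ → ℝ}
    (h : ∀ ε : ℝ, 0 < ε → ε < 1 →
      HoldsAas p fun n => {G | (G.metricDimension : ℝ) ≤ (1 + ε) * f n}) :
    MetricDimensionAasLe p f := by
  let P : ℕ → ℝ → ℝ := fun n ε => (SimpleGraph.binomialRandom (Fin n) (p n)).real
    {G | (G.metricDimension : ℝ) ≤ (1 + ε) * f n}
  -- Diagonalisation: the same `ε` bounds the excess and the failure probability, and `δ n` is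
  -- chosen within `1 / (n + 1)` of the infimum, which need not be attained. The set contains `1`
  -- because that condition is then void.
  let S : ℕ → Set ℝ := fun n => {ε | 0 < ε ∧ 1 - ε ≤ P n ε}
  have hS : ∀ n, (S n).Nonempty := fun n => ⟨1, one_pos, by
    rw [sub_self]; exact measureReal_nonneg⟩
  have hbdd : ∀ n, BddBelow (S n) := fun n => ⟨0, fun x hx => hx.1.le⟩
  have hex : ∀ n : ℕ, ∃ δ ∈ S n, δ < sInf (S n) + 1 / ((n : ℝ) + 1) := fun n =>
    exists_lt_of_csInf_lt (hS n) (lt_add_of_pos_right _ (by positivity))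
  choose δ hδS hδ using hex
  have hδ0 : Tendsto δ atTop (𝓝 0) := by
    refine Metric.tendsto_atTop.mpr fun ε hε => ?_
    set ε' := min (ε / 2) (1 / 2)
    have hε' : 0 < ε' := by positivity
    have hε'' : ε' ≤ ε / 2 := min_le_left _ _
    have h1 : ∀ᶠ n in atTop, 1 - ε' < P n ε' :=
      (h ε' hε' ((min_le_right _ _).trans_lt (by norm_num))).eventually_const_lt (by linarith)
    have h2 : ∀ᶠ n : ℕ in atTop, 1 / ((n : ℝ) + 1) < ε / 2 :=
      tendsto_one_div_add_atTop_nhds_zero_nat.eventually_lt_const (by positivity)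
    obtain ⟨N, hN⟩ := eventually_atTop.mp (h1.and h2)
    refine ⟨N, fun n hn => ?_⟩
    have h3 : sInf (S n) ≤ ε' := csInf_le (hbdd n) ⟨hε', (hN n hn).1.le⟩
    rw [Real.dist_eq, sub_zero, abs_of_pos (hδS n).1]
    linarith [hδ n, (hN n hn).2]
  refine ⟨δ, hδ0, ?_⟩
  have h1 : Tendsto (fun n => 1 - δ n) atTop (𝓝 1) := by simpa using hδ0.const_sub 1
  exact tendsto_of_tendsto_of_tendsto_of_le_of_le h1 tendsto_const_nhds
    (fun n => (hδS n).2) (fun n => measureReal_le_one)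

theorem HoldsAas.mono {p : ℕ → unitInterval} {A B : ∀ n : ℕ, Set (SimpleGraph (Fin n))}
    (hA : HoldsAas p A) (h : ∀ᶠ n in atTop, A n ⊆ B n) : HoldsAas p B := by
  refine tendsto_of_tendsto_of_tendsto_of_le_of_le' hA tendsto_const_nhds ?_
    (Eventually.of_forall fun n => measureReal_le_one)
  filter_upwards [h] with n hn
  exact measureReal_mono hn (measure_ne_top _ _)

theorem MetricDimensionAasLe.congr_isEquivalent {p : ℕ → unitInterval} {f g : ℕ → ℝ}
    (hf : MetricDimensionAasLe p f) (h : f ~[atTop] g) : MetricDimensionAasLe p g := by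
  obtain ⟨δ, hδ, hA⟩ := hf
  obtain ⟨u, hu, hfu⟩ := h.exists_eq_mul
  refine ⟨fun n => (1 + δ n) * u n - 1, ?_, hA.mono ?_⟩
  · simpa using ((hδ.const_add 1).mul hu).sub_const 1
  · filter_upwards [hfu] with n hn G hG
    simp only [Set.mem_ofPred_eq, Pi.mul_apply] at hG hn ⊢
    rw [hn] at hG
    linarith

/-- If a.a.s. any vertex `v` is closer than `w` to at least a proportion `y / 2` of the vertices,
and `1 - y ≤ exp (-ℓ)`, then the metric dimension is a.a.s. at most about `2 log n / ℓ`. -/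
theorem holdsAas_metricDimension_le {p : ℕ → unitInterval} {y ℓ f : ℕ → ℝ} {ε : ℝ}
    (hT : HoldsAas p fun n => {G | ∀ v w : Fin n, v ≠ w → n * y n / 2 ≤ closerCount G v w})
    (hℓ : ∀ᶠ n in atTop, 0 < ℓ n) (hy1 : ∀ᶠ n in atTop, y n ≤ 1)
    (hy : ∀ᶠ n in atTop, 1 - y n ≤ Real.exp (-ℓ n))
    (hf : ∀ᶠ n : ℕ in atTop, 2 * Real.log n / ℓ n ≤ (1 + ε / 2) * f n)
    (hf1 : ∀ᶠ n in atTop, 1 ≤ ε / 2 * f n) :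
    HoldsAas p fun n => {G | (G.metricDimension : ℝ) ≤ (1 + ε) * f n} := by
  refine hT.mono ?_
  filter_upwards [hℓ, hy1, hy, hf, hf1, eventually_ge_atTop 1] with n hℓ hy1 hy hf hf1 hn G hG
  have hG' : ∀ v w : Fin n, v ≠ w → n * y n / 2 ≤ closerCount G v w := hG
  have hnpos : (0 : ℝ) < n := by exact_mod_cast hn
  have hlog : 0 ≤ Real.log n := Real.log_nonneg (by exact_mod_cast hn)
  -- The extra `1` makes `r ℓ > 2 log n` strict; its cost is absorbed by `hf1`.
  set r := ⌊2 * Real.log n / ℓ n⌋₊ + 1 with hr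
  have hr1 : 2 * Real.log n < r * ℓ n := by
    have := Nat.lt_floor_add_one (2 * Real.log n / ℓ n)
    rw [div_lt_iff₀ hℓ] at this
    rw [hr]; push_cast; exact this
  have hr2 : (r : ℝ) ≤ 2 * Real.log n / ℓ n + 1 := by
    rw [hr]; push_cast
    linarith [Nat.floor_le (by positivity : 0 ≤ 2 * Real.log n / ℓ n)]
  have key : (n : ℝ) ^ 2 * (1 - y n) ^ r < 1 := by
    have h1 : (1 - y n) ^ r ≤ Real.exp (-(r * ℓ n)) := by
      calc (1 - y n) ^ r ≤ Real.exp (-ℓ n) ^ r := pow_le_pow_left₀ (by linarith) hy r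
        _ = _ := by rw [← Real.exp_nat_mul]; ring_nf
    have h2 : (n : ℝ) ^ 2 = Real.exp (2 * Real.log n) := by
      rw [show 2 * Real.log n = Real.log ((n : ℝ) ^ 2) by rw [Real.log_pow]; norm_num,
        Real.exp_log (by positivity)]
    calc _ ≤ Real.exp (2 * Real.log n) * Real.exp (-(r * ℓ n)) := by
          rw [h2]; exact mul_le_mul_of_nonneg_left h1 (Real.exp_nonneg _)
      _ = Real.exp (2 * Real.log n - r * ℓ n) := by rw [← Real.exp_add]; ring_nf
      _ < 1 := by rw [← Real.exp_zero]; exact Real.exp_lt_exp.mpr (by linarith)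
  have : G.metricDimension ≤ r := by
    refine SimpleGraph.metricDimension_le_of_separators (s := n * y n) (fun v w hvw => ?_)
      (by rwa [Fintype.card_fin, mul_div_cancel_left₀ _ hnpos.ne'])
    have h1 := (Nat.cast_le (α := ℝ)).mpr (closerCount_add_closerCount_le G v w)
    rw [Nat.cast_add] at h1
    linarith [hG' v w hvw, hG' w v hvw.symm]
  have h3 : (G.metricDimension : ℝ) ≤ r := Nat.cast_le.mpr this
  simp only [Set.mem_ofPred_eq]
  linarith

end ResolvingSets

/-! ### The case `p = Θ(1)`: resolving by adjacency to a fixed set. -/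

section DenseCase

open MeasureTheory ProbabilityTheory

variable {V : Type*} [Fintype V]

theorem measureReal_adj_iff_adj (p : unitInterval) {v w z : V} (hvw : v ≠ w) (hvz : z ≠ v)
    (hwz : z ≠ w) :
    (edgeMeasure V p).real {ω | (graphOfEdges ω).Adj z v ↔ (graphOfEdges ω).Adj z w} =
      (p : ℝ) ^ 2 + (1 - (p : ℝ)) ^ 2 := by
  classical
  have hdis : Disjoint (starEdges z {v}) (starEdges z {w}) :=
    starEdges_disjoint (by simpa using hvw)
  have h1 := measureReal_and_of_dependsOn (iIndepFun_edgeMeasure (V := V) p) hdis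
    (dependsOn_exists_adj z {v}) (dependsOn_exists_adj z {w})
  have h2 := measureReal_and_of_dependsOn (iIndepFun_edgeMeasure (V := V) p) hdis
    (dependsOn_forall_not_adj z {v}) (dependsOn_forall_not_adj z {w})
  rw [measureReal_exists_adj p (by simpa using hvz),
    measureReal_exists_adj p (by simpa using hwz)] at h1
  rw [measureReal_forall_not_adj p (by simpa using hvz),
    measureReal_forall_not_adj p (by simpa using hwz)] at h2
  simp only [Finset.mem_singleton, exists_eq_left, forall_eq, Finset.card_singleton,
    pow_one] at h1 h2
  have e : {ω : Sym2 V → Prop | (graphOfEdges ω).Adj z v ↔ (graphOfEdges ω).Adj z w} =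
      {ω | (graphOfEdges ω).Adj z v ∧ (graphOfEdges ω).Adj z w} ∪
      {ω | ¬ (graphOfEdges ω).Adj z v ∧ ¬ (graphOfEdges ω).Adj z w} := by
    ext ω; simp only [Set.mem_ofPred_eq, Set.mem_union]; tauto
  rw [e, measureReal_union _ .of_discrete, h1, h2]
  · ring
  · rw [Set.disjoint_left]
    rintro ω ⟨h, -⟩ ⟨h', -⟩
    exact h' h

theorem measureReal_forall_adj_iff_adj (p : unitInterval) {v w : V} (hvw : v ≠ w) {R : Finset V}
    (hv : v ∉ R) (hw : w ∉ R) :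
    (edgeMeasure V p).real
      {ω | ∀ z ∈ R, (graphOfEdges ω).Adj z v ↔ (graphOfEdges ω).Adj z w} =
      ((p : ℝ) ^ 2 + (1 - (p : ℝ)) ^ 2) ^ R.card := by
  classical
  rw [measureReal_forall_of_dependsOn (iIndepFun_edgeMeasure (V := V) p) R
    (fun z ω => (graphOfEdges ω).Adj z v ↔ (graphOfEdges ω).Adj z w)
    (fun z => starEdges z {v, w})
    (pairwiseDisjoint_starEdges (by simp [hv, hw]))
    (fun z _ ω ω' h => propext (iff_congr
      (adj_congr_of_mem (h _ (by exact_mod_cast mem_starEdges (by simp))))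
      (adj_congr_of_mem (h _ (by exact_mod_cast mem_starEdges (by simp))))))]
  rw [Finset.prod_congr rfl fun z hz => measureReal_adj_iff_adj p hvw
    (fun e : z = v => hv (e ▸ hz)) (fun e : z = w => hw (e ▸ hz)), Finset.prod_const]

/-- A vertex of `R` is distinguished from all others by its distance `0` to itself. Two vertices
outside `R` with equal distances to `R` have in particular the same neighbours in `R`, and the
events for the single elements of `R` are independent of probability `p² + (1 - p)²`. -/
theorem measureReal_not_isResolvingSet_le (p : unitInterval) (R : Finset V) :
    (edgeMeasure V p).real {ω | ¬ (graphOfEdges ω).IsResolvingSet R} ≤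
      (Fintype.card V : ℝ) ^ 2 * ((p : ℝ) ^ 2 + (1 - (p : ℝ)) ^ 2) ^ R.card := by
  classical
  have hsub : {ω : Sym2 V → Prop | ¬ (graphOfEdges ω).IsResolvingSet R} ⊆
      ⋃ x ∈ (Finset.univ : Finset (V × V)), {ω | (x.1 ≠ x.2 ∧ x.1 ∉ R ∧ x.2 ∉ R) ∧
        ∀ z ∈ R, (graphOfEdges ω).Adj z x.1 ↔ (graphOfEdges ω).Adj z x.2} := by
    intro ω hω
    rw [Set.mem_ofPred_eq, SimpleGraph.isResolvingSet_iff] at hω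
    push Not at hω
    obtain ⟨v, w, hvw, h⟩ := hω
    simp only [Set.mem_iUnion]
    refine ⟨(v, w), Finset.mem_univ _, ⟨hvw, fun hv => hvw ?_, fun hw => hvw ?_⟩, fun z hz => ?_⟩
    · have := h v hv
      rw [SimpleGraph.edist_self] at this
      exact (SimpleGraph.edist_eq_zero_iff.mp this.symm).symm
    · have := h w hw
      rw [SimpleGraph.edist_self] at this
      exact SimpleGraph.edist_eq_zero_iff.mp this
    · rw [SimpleGraph.adj_comm, (graphOfEdges ω).adj_comm z, ← SimpleGraph.edist_eq_one_iff_adj,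
        ← SimpleGraph.edist_eq_one_iff_adj, h z hz]
  have hq : 0 ≤ ((p : ℝ) ^ 2 + (1 - (p : ℝ)) ^ 2) ^ R.card := by positivity
  calc _ ≤ _ := measureReal_mono hsub (measure_ne_top _ _)
    _ ≤ _ := measureReal_biUnion_finset_le _ _
    _ ≤ ∑ _x ∈ (Finset.univ : Finset (V × V)), ((p : ℝ) ^ 2 + (1 - (p : ℝ)) ^ 2) ^ R.card := by
        refine Finset.sum_le_sum fun x _ => ?_
        by_cases hx : x.1 ≠ x.2 ∧ x.1 ∉ R ∧ x.2 ∉ R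
        · refine le_trans (measureReal_mono (fun ω hω => hω.2) (measure_ne_top _ _))
            (measureReal_forall_adj_iff_adj p hx.1 hx.2.1 hx.2.2).le
        · simpa [hx] using hq
    _ = _ := by simp [sq]

theorem half_le_sq_add_sq (x : ℝ) : 1 / 2 ≤ x ^ 2 + (1 - x) ^ 2 := by
  nlinarith [sq_nonneg (2 * x - 1)]

theorem sq_add_sq_lt_one {x : ℝ} (h0 : 0 < x) (h1 : x < 1) : x ^ 2 + (1 - x) ^ 2 < 1 := by
  nlinarith

theorem log_inv_pos {q : ℝ} (h0 : 1 / 2 ≤ q) (h1 : q < 1) : 0 < Real.log (1 / q) := by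
  rw [one_div, Real.log_inv]
  linarith [Real.log_neg (by linarith) h1]

theorem log_inv_le_one {q : ℝ} (h0 : 1 / 2 ≤ q) : Real.log (1 / q) ≤ 1 := by
  have h : Real.log (1 / q) ≤ 1 / q - 1 := Real.log_le_sub_one_of_pos (by positivity)
  have : 1 / q ≤ 2 := by rw [div_le_iff₀ (by linarith)]; linarith
  linarith

theorem two_mul_le_two_mul_div_log_inv {q t : ℝ} (h0 : 1 / 2 ≤ q) (h1 : q < 1) (ht : 0 ≤ t) :
    2 * t ≤ 2 * t / Real.log (1 / q) := by
  rw [le_div_iff₀ (log_inv_pos h0 h1)]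
  exact mul_le_of_le_one_right (by positivity) (log_inv_le_one h0)

theorem metricDimensionAasLe_of_dense {p : ℕ → unitInterval} {q : ℕ → ℝ}
    (hq : ∀ n, q n = (p n : ℝ) ^ 2 + (1 - (p n : ℝ)) ^ 2)
    (hp0 : ∀ᶠ n in atTop, 0 < (p n : ℝ)) (hp1 : ∀ᶠ n in atTop, (p n : ℝ) < 1) :
    MetricDimensionAasLe p fun n => 2 * Real.log n / Real.log (1 / q n) := by
  refine metricDimensionAasLe_of_forall fun ε hε0 _ => ?_
  have hlog : Tendsto (fun n : ℕ => Real.log n) atTop atTop :=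
    Real.tendsto_log_atTop.comp tendsto_natCast_atTop_atTop
  refine holdsAas_of_measureReal_not_le (b := fun n : ℕ => Real.exp (-(ε * Real.log n))) ?_ ?_
  · exact Real.tendsto_exp_neg_atTop_nhds_zero.comp (hlog.const_mul_atTop hε0)
  filter_upwards [hp0, hp1, hlog.eventually_ge_atTop (1 / ε), eventually_ge_atTop 1]
    with n h0 h1 hln hn
  have hq0 : 1 / 2 ≤ q n := hq n ▸ half_le_sq_add_sq _
  have hq1 : q n < 1 := hq n ▸ sq_add_sq_lt_one h0 h1
  have hL := log_inv_pos hq0 hq1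
  have hl0 : 0 ≤ Real.log n := le_trans (by positivity) hln
  have hF := two_mul_le_two_mul_div_log_inv hq0 hq1 hl0
  have hnpos : (0 : ℝ) < n := by exact_mod_cast hn
  set F := 2 * Real.log n / Real.log (1 / q n) with hFdef
  set r := ⌊(1 + ε / 2) * F⌋₊ + 1 with hr
  have hr1 : (1 + ε / 2) * F < r := by
    rw [hr]; push_cast; exact Nat.lt_floor_add_one _
  have hr2 : (r : ℝ) ≤ (1 + ε) * F := by
    have hF0 : 0 ≤ F := by linarith
    have h3 := Nat.floor_le (by positivity : 0 ≤ (1 + ε / 2) * F)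
    have h4 : 1 ≤ ε / 2 * F := by
      rw [div_le_iff₀ hε0] at hln
      nlinarith
    rw [hr]; push_cast; linarith
  -- When `r` exceeds `n`, as may happen for `p` very close to `1`, the whole vertex set serves.
  obtain ⟨R, hR1, hR2⟩ : ∃ R : Finset (Fin n), (R = Finset.univ ∨ R.card = r) ∧ R.card ≤ r := by
    rcases le_total n r with hnr | hnr
    · exact ⟨Finset.univ, Or.inl rfl, by simpa using hnr⟩
    · obtain ⟨R, -, hR⟩ := Finset.exists_subset_card_eq (s := (Finset.univ : Finset (Fin n)))
        (n := r) (by simpa using hnr)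
      exact ⟨R, Or.inr hR, hR.le⟩
  have hsub : {ω : Sym2 (Fin n) → Prop | ¬ graphOfEdges ω ∈ {G : SimpleGraph (Fin n) |
      (G.metricDimension : ℝ) ≤ (1 + ε) * F}} ⊆
      {ω | ¬ (graphOfEdges ω).IsResolvingSet R} := by
    intro ω hω hres
    refine hω (le_trans ?_ hr2)
    exact_mod_cast (SimpleGraph.metricDimension_le hres).trans hR2
  refine (measureReal_mono hsub (measure_ne_top _ _)).trans ?_
  rcases hR1 with rfl | hR1
  · simp [SimpleGraph.isResolvingSet_univ, Real.exp_nonneg]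
  · refine (measureReal_not_isResolvingSet_le (p n) R).trans ?_
    rw [← hq, hR1, Fintype.card_fin]
    have e1 : (n : ℝ) ^ 2 = Real.exp (2 * Real.log n) := by
      rw [show 2 * Real.log n = Real.log ((n : ℝ) ^ 2) by rw [Real.log_pow]; norm_num,
        Real.exp_log (by positivity)]
    have e2 : q n ^ r = Real.exp (-(r * Real.log (1 / q n))) := by
      rw [one_div, Real.log_inv, mul_neg, neg_neg, Real.exp_nat_mul, Real.exp_log (by linarith)]
    rw [e1, e2, ← Real.exp_add]
    refine Real.exp_le_exp.mpr ?_
    have h5 := mul_le_mul_of_nonneg_right hr1.le hL.le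
    have h6 : (1 + ε / 2) * F * Real.log (1 / q n) = (1 + ε / 2) * (2 * Real.log n) := by
      rw [hFdef]; field_simp
    rw [h6] at h5
    linarith

end DenseCase

/-! ### The case `p = o(1)`: optimising the number of random vertices. -/

section SparseCase

theorem tendsto_log_natCast : Tendsto (fun n : ℕ => Real.log n) atTop atTop :=
  Real.tendsto_log_atTop.comp tendsto_natCast_atTop_atTop

theorem avgDegree_nonneg (p : ℕ → unitInterval) {n : ℕ} (hn : 1 ≤ n) : 0 ≤ avgDegree p n := by
  have : (1 : ℝ) ≤ n := by exact_mod_cast hn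
  exact mul_nonneg (p n).2.1 (by linarith)

/-- Shrinking `y` by the factor `1 - ε` lowers `-log (1 - y)` by at most `ε y / (1 - y) ≤ 2 ε y`,
and `y ≤ -log (1 - y)`. The estimate is uniform in `y`, so `c` need not converge. -/
theorem neg_log_one_sub_mul_ge {y ε : ℝ} (hy0 : 0 ≤ y) (hy1 : y ≤ 1 / 2) (hε0 : 0 ≤ ε) :
    (1 - 2 * ε) * -Real.log (1 - y) ≤ -Real.log (1 - (1 - ε) * y) := by
  have h1 : 0 < 1 - y := by linarith
  have h2 : 0 < 1 - (1 - ε) * y := by nlinarith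
  have h3 : Real.log ((1 - (1 - ε) * y) / (1 - y)) ≤ (1 - (1 - ε) * y) / (1 - y) - 1 :=
    Real.log_le_sub_one_of_pos (by positivity)
  rw [Real.log_div h2.ne' h1.ne'] at h3
  have h4 : (1 - (1 - ε) * y) / (1 - y) - 1 ≤ 2 * ε * y := by
    rw [sub_le_iff_le_add, div_le_iff₀ h1]
    nlinarith [mul_nonneg hε0 hy0, mul_nonneg (mul_nonneg hε0 hy0) (by linarith : 0 ≤ 1 / 2 - y)]
  have h5 : y ≤ -Real.log (1 - y) := by linarith [Real.log_le_sub_one_of_pos h1]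
  nlinarith [mul_le_mul_of_nonneg_left h5 hε0]

variable {p : ℕ → unitInterval} {d : ℕ → ℝ} {i : ℕ → ℕ} {c : ℕ → ℝ}

/-- For `p → 0` one has `d = o(n)`, so maximality of `i` can be tested against the constant exponent
`1`. -/
theorem IsLargestExponent.eventually_one_le (hi : IsLargestExponent d i)
    (hd : ∀ n, d n = avgDegree p n) (hp : Tendsto (fun n => (p n : ℝ)) atTop (𝓝 0)) :
    ∀ᶠ n in atTop, 1 ≤ i n := by
  refine hi.2 (fun _ => 1) ?_
  have h1 : (fun n => (p n : ℝ)) =o[atTop] (fun _ => (1 : ℝ)) := (isLittleO_one_iff ℝ).mpr hp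
  have h2 : (fun n : ℕ => (n : ℝ) - 1) =O[atTop] (fun n : ℕ => (n : ℝ)) := by
    refine IsBigO.of_bound 1 ?_
    filter_upwards [eventually_ge_atTop 1] with n hn
    have : (1 : ℝ) ≤ n := by exact_mod_cast hn
    rw [Real.norm_of_nonneg (by linarith), Real.norm_of_nonneg (by linarith)]
    linarith
  simpa [hd, avgDegree] using h1.mul_isBigO h2

/-- If `p` is bounded below then `i = 0` and `c` stays bounded. -/
theorem IsLargestExponent.not_tendsto_of_dense (hi : IsLargestExponent d i)
    (hd : ∀ n, d n = avgDegree p n) (hc : ∀ n, c n = d n ^ (i n + 1) / n) {a : ℝ} (ha : 0 < a)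
    (hp : ∀ᶠ n in atTop, a ≤ (p n : ℝ)) : ¬ Tendsto c atTop atTop := by
  intro hct
  have h1 := hi.1.bound (by positivity : 0 < a / 4)
  obtain ⟨n, hn, hn2, hpn, hcn, hna⟩ := (h1.and ((eventually_ge_atTop 2).and (hp.and
    ((hct.eventually_ge_atTop 2).and
      (tendsto_natCast_atTop_atTop.eventually_ge_atTop (2 / a)))))).exists
  have hn' : (2 : ℝ) ≤ n := by exact_mod_cast hn2
  have hdn : d n = p n * ((n : ℝ) - 1) := hd n
  have hd1 : a / 2 * n ≤ d n := by
    rw [hdn]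
    nlinarith [mul_le_mul_of_nonneg_right hpn (by linarith : (0 : ℝ) ≤ n - 1)]
  have hd2 : 1 ≤ d n := by
    rw [div_le_iff₀ ha] at hna
    linarith
  have hd3 : d n ≤ n := by rw [hdn]; nlinarith [(p n).2.1, (p n).2.2]
  rcases Nat.eq_zero_or_pos (i n) with h0 | h0
  · rw [hc, h0, zero_add, pow_one, le_div_iff₀ (by linarith)] at hcn
    linarith
  · have h2 : d n ≤ d n ^ i n := le_self_pow₀ hd2 (by omega)
    rw [Real.norm_of_nonneg (by positivity), Real.norm_of_nonneg (by positivity)] at hn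
    nlinarith

theorem metricDimensionAasLe_of_bounded {q : ℕ → ℝ} (hd : ∀ n, d n = avgDegree p n)
    (hd_large : (fun n : ℕ => Real.log n ^ 3) =o[atTop] d)
    (hp : Tendsto (fun n => (p n : ℝ)) atTop (𝓝 0)) (hi : IsLargestExponent d i)
    (hc : ∀ n, c n = d n ^ (i n + 1) / n) {c₀ : ℝ} (hc₀ : 0 < c₀)
    (hcc : ∀ᶠ n in atTop, c₀ ≤ c n)
    (hq : ∀ n, q n = Real.exp (-c n) ^ 2 + (1 - Real.exp (-c n)) ^ 2) :
    MetricDimensionAasLe p fun n => 2 * Real.log n / Real.log (1 / q n) := by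
  refine metricDimensionAasLe_of_forall fun ε hε0 hε1 => ?_
  have hx : ∀ᶠ n in atTop, 0 < Real.exp (-c n) ∧ Real.exp (-c n) < 1 := by
    filter_upwards [hcc] with n hn
    refine ⟨Real.exp_pos _, ?_⟩
    rw [← Real.exp_zero]
    exact Real.exp_lt_exp.mpr (by linarith)
  have hT := holdsAas_le_closerCount p d hd hd_large hp i (hi.eventually_one_le hd hp) hi.1 c hc
    hc₀ hcc (ε := ε / 8) (by positivity) (by linarith)
  -- The term `d ^ i` is dropped, and `2 x (1 - x) = 1 - q` for `x = e^{-c}`. The exponent `ℓ` is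
  -- exact, because the proportion need not be small.
  refine holdsAas_metricDimension_le (y := fun n => (1 - ε / 8) * (1 - q n))
    (ℓ := fun n => -Real.log (1 - (1 - ε / 8) * (1 - q n))) (hT.mono ?_) ?_ ?_ ?_ ?_ ?_
  · filter_upwards [eventually_ge_atTop 1] with n hn G hG v w hvw
    refine le_trans ?_ (hG v w hvw)
    have h0 : 0 ≤ d n ^ i n := pow_nonneg (hd n ▸ avgDegree_nonneg p hn) _
    have h1 : 0 ≤ (1 - ε / 8) * d n ^ i n := mul_nonneg (by linarith) h0
    simp only [hq]
    linarith
  · filter_upwards [hx] with n hn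
    have h1 := sq_add_sq_lt_one hn.1 hn.2
    have h2 := half_le_sq_add_sq (Real.exp (-c n))
    rw [← hq] at h1 h2
    have h3 : 0 < (1 - ε / 8) * (1 - q n) := mul_pos (by linarith) (by linarith)
    have h4 : 0 < 1 - (1 - ε / 8) * (1 - q n) := by nlinarith
    linarith [Real.log_le_sub_one_of_pos h4]
  · refine Eventually.of_forall fun n => ?_
    have h2 := half_le_sq_add_sq (Real.exp (-c n))
    rw [← hq] at h2
    nlinarith
  · refine Eventually.of_forall fun n => ?_
    have h2 := half_le_sq_add_sq (Real.exp (-c n))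
    rw [← hq] at h2
    rw [neg_neg, Real.exp_log (by nlinarith)]
  · filter_upwards [hx, eventually_ge_atTop 1] with n hn hn1
    have h1 := sq_add_sq_lt_one hn.1 hn.2
    have h2 := half_le_sq_add_sq (Real.exp (-c n))
    rw [← hq] at h1 h2
    have hL := log_inv_pos h2 h1
    have h3 := neg_log_one_sub_mul_ge (y := 1 - q n) (ε := ε / 8) (by linarith) (by linarith)
      (by positivity)
    rw [sub_sub_cancel, ← Real.log_inv, ← one_div] at h3
    have hl : 0 ≤ Real.log n := Real.log_nonneg (by exact_mod_cast hn1)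
    have h5 : 0 < 1 - 2 * (ε / 8) := by linarith
    calc 2 * Real.log n / -Real.log (1 - (1 - ε / 8) * (1 - q n))
        ≤ 2 * Real.log n / ((1 - 2 * (ε / 8)) * Real.log (1 / q n)) :=
          div_le_div_of_nonneg_left (by positivity) (by positivity) h3
      _ = (1 - 2 * (ε / 8))⁻¹ * (2 * Real.log n / Real.log (1 / q n)) := by
          field_simp
      _ ≤ _ := by
          refine mul_le_mul_of_nonneg_right ?_ (by positivity)
          rw [inv_le_iff_one_le_mul₀ h5]
          nlinarith
  · filter_upwards [hx, tendsto_log_natCast.eventually_ge_atTop (1 / ε)] with n hn hln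
    have h1 := sq_add_sq_lt_one hn.1 hn.2
    have h2 := half_le_sq_add_sq (Real.exp (-c n))
    rw [← hq] at h1 h2
    have hl : 0 ≤ Real.log n := le_trans (by positivity) hln
    have h3 := two_mul_le_two_mul_div_log_inv h2 h1 hl
    rw [div_le_iff₀ hε0] at hln
    nlinarith

theorem metricDimensionAasLe_of_tendsto_atTop (hd : ∀ n, d n = avgDegree p n)
    (hd_large : (fun n : ℕ => Real.log n ^ 3) =o[atTop] d)
    (hp : Tendsto (fun n => (p n : ℝ)) atTop (𝓝 0)) (hi : IsLargestExponent d i)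
    (hc : ∀ n, c n = d n ^ (i n + 1) / n) (hct : Tendsto c atTop atTop)
    (hg : Tendsto (fun n => d n ^ i n / n + Real.exp (-c n)) atTop (𝓝 0)) :
    MetricDimensionAasLe p fun n => (d n ^ i n / n + Real.exp (-c n))⁻¹ * Real.log n := by
  refine metricDimensionAasLe_of_forall fun ε hε0 hε1 => ?_
  have hT := holdsAas_le_closerCount p d hd hd_large hp i (hi.eventually_one_le hd hp) hi.1 c hc
    one_pos (hct.eventually_ge_atTop 1) (ε := ε / 8) (by positivity) (by linarith)
  have hx0 : Tendsto (fun n => Real.exp (-c n)) atTop (𝓝 0) :=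
    Real.tendsto_exp_neg_atTop_nhds_zero.comp hct
  have hgpos : ∀ᶠ n in atTop, 0 < d n ^ i n / n + Real.exp (-c n) := by
    filter_upwards [eventually_ge_atTop 1] with n hn
    have : 0 ≤ d n ^ i n := pow_nonneg (hd n ▸ avgDegree_nonneg p hn) _
    have := Real.exp_pos (-c n)
    positivity
  -- The proportion now tends to `0`, so `1 - y ≤ e^{-y}` loses nothing to first order and `ℓ = y`.
  -- One factor `1 - ε / 8` is the concentration loss; the other replaces `1 - e^{-c}`.
  refine holdsAas_metricDimension_le
    (y := fun n => 2 * (1 - ε / 8) ^ 2 * (d n ^ i n / n + Real.exp (-c n)))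
    (ℓ := fun n => 2 * (1 - ε / 8) ^ 2 * (d n ^ i n / n + Real.exp (-c n)))
    (hT.mono ?_) ?_ ?_ ?_ ?_ ?_
  · filter_upwards [eventually_ge_atTop 1,
      hx0.eventually_lt_const (by positivity : 0 < ε / 8)] with n hn hxn G hG v w hvw
    refine le_trans ?_ (hG v w hvw)
    have hn0 : (0 : ℝ) < n := by exact_mod_cast hn
    have h0 : 0 ≤ d n ^ i n := pow_nonneg (hd n ▸ avgDegree_nonneg p hn) _
    have hx := Real.exp_pos (-c n)
    set x := Real.exp (-c n)
    have h1 : n * (2 * (1 - ε / 8) ^ 2 * (d n ^ i n / n + x)) / 2 =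
        (1 - ε / 8) * ((1 - ε / 8) * d n ^ i n + n * (x * (1 - ε / 8))) := by
      field_simp
    rw [h1]
    refine mul_le_mul_of_nonneg_left (add_le_add ?_ ?_) (by linarith)
    · exact mul_le_of_le_one_left h0 (by linarith)
    · gcongr
  · filter_upwards [hgpos] with n hn
    have : 0 < 1 - ε / 8 := by linarith
    positivity
  · filter_upwards [hg.eventually_lt_const (by norm_num : (0 : ℝ) < 1 / 2), hgpos] with n hn hn0
    have : (1 - ε / 8) ^ 2 ≤ 1 := pow_le_one₀ (by linarith) (by linarith)
    nlinarith
  · refine Eventually.of_forall fun n => ?_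
    linarith [Real.add_one_le_exp (-(2 * (1 - ε / 8) ^ 2 * (d n ^ i n / n + Real.exp (-c n))))]
  · filter_upwards [hgpos, eventually_ge_atTop 1] with n hn hn1
    have hl : 0 ≤ Real.log n := Real.log_nonneg (by exact_mod_cast hn1)
    have h1 : 0 < 1 - ε / 8 := by linarith
    set g := d n ^ i n / n + Real.exp (-c n)
    calc 2 * Real.log n / (2 * (1 - ε / 8) ^ 2 * g)
        = ((1 - ε / 8) ^ 2)⁻¹ * (g⁻¹ * Real.log n) := by field_simp
      _ ≤ _ := by
        refine mul_le_mul_of_nonneg_right ?_ (by positivity)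
        rw [inv_le_iff_one_le_mul₀ (by positivity)]
        nlinarith [mul_nonneg hε0.le (by linarith : 0 ≤ 1 - ε), sq_nonneg ε,
          mul_nonneg (sq_nonneg ε) hε0.le]
  · filter_upwards [hgpos, hg.eventually_lt_const one_pos,
      tendsto_log_natCast.eventually_ge_atTop (2 / ε)] with n hn hn1 hln
    have h1 : 1 ≤ (d n ^ i n / n + Real.exp (-c n))⁻¹ := (one_le_inv₀ hn).mpr hn1.le
    have hl : 0 ≤ Real.log n := le_trans (by positivity) hln
    have h2 := le_mul_of_one_le_left hl h1
    rw [div_le_iff₀ hε0] at hln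
    nlinarith

theorem inv_mul_isEquivalent {f g : ℕ → ℝ} (h : f ~[atTop] g) (u : ℕ → ℝ) :
    (fun n => (f n)⁻¹ * u n) ~[atTop] fun n => (g n)⁻¹ * u n :=
  h.inv.mul IsEquivalent.refl

/-- With `q = x² + (1 - x)²`, the two bounds `1 - q ≤ log (1 / q) ≤ 1 / q - 1` and `1 - q = 2 x (1 -
x)` squeeze the ratio between `1 - x` and `(1 - x) / q`. -/
theorem log_inv_isEquivalent {x : ℕ → ℝ} (hx0 : ∀ n, 0 < x n) (hx : Tendsto x atTop (𝓝 0)) :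
    (fun n => Real.log (1 / (x n ^ 2 + (1 - x n) ^ 2))) ~[atTop] fun n => 2 * x n := by
  refine isEquivalent_of_tendsto_one ?_
  have h1 : Tendsto (fun n => 1 - x n) atTop (𝓝 1) := by simpa using hx.const_sub 1
  have h2 : Tendsto (fun n => (1 - x n) / (x n ^ 2 + (1 - x n) ^ 2)) atTop (𝓝 1) := by
    have := h1.div ((hx.pow 2).add (h1.pow 2)) (by norm_num)
    norm_num at this
    exact this
  refine tendsto_of_tendsto_of_tendsto_of_le_of_le h1 h2 (fun n => ?_) (fun n => ?_)
  · have hq : 0 < x n ^ 2 + (1 - x n) ^ 2 := by linarith [half_le_sq_add_sq (x n)]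
    simp only [Pi.div_apply]
    rw [le_div_iff₀ (by linarith [hx0 n]), one_div, Real.log_inv]
    nlinarith [Real.log_le_sub_one_of_pos hq]
  · have hq : 0 < x n ^ 2 + (1 - x n) ^ 2 := by linarith [half_le_sq_add_sq (x n)]
    simp only [Pi.div_apply]
    rw [div_le_iff₀ (by linarith [hx0 n])]
    refine (Real.log_le_sub_one_of_pos (by positivity)).trans (le_of_eq ?_)
    field_simp
    ring

end SparseCase

/-! ### Assembly of the two regimes of `c`. -/

theorem theorem3p1 (p : ℕ → unitInterval)
    (d : ℕ → ℝ) (hd : ∀ n, d n = avgDegree p n)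
    (hd_large : (fun n : ℕ => Real.log n ^ 3) =o[atTop] d)
    (hd_compl : (fun n : ℕ => Real.log n) =o[atTop] (fun n : ℕ => (n : ℝ) - d n))
    (i : ℕ → ℕ) (hi : IsLargestExponent d i)
    (c : ℕ → ℝ) (hc : ∀ n, c n = d n ^ (i n + 1) / n)
    (q : ℕ → ℝ) (hq : IsCollisionParameter p c q) :
    (c =Θ[atTop] (fun _ => (1 : ℝ)) →
      MetricDimensionAasLe p (fun n => 2 * Real.log n / Real.log (1 / q n)) ∧
      ((fun n : ℕ => Real.log n) =O[atTop]
        (fun n : ℕ => 2 * Real.log n / Real.log (1 / q n))) ∧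
      (((fun _ => (1 : ℝ)) =O[atTop] (fun n => 1 - (p n : ℝ))) →
        (fun n : ℕ => 2 * Real.log n / Real.log (1 / q n)) =Θ[atTop]
          (fun n : ℕ => Real.log n))) ∧
    (Tendsto c atTop atTop →
      MetricDimensionAasLe p
        (fun n => (d n ^ i n / n + Real.exp (-c n))⁻¹ * Real.log n) ∧
      ((fun n : ℕ => Real.log n) =o[atTop]
        (fun n : ℕ => (d n ^ i n / n + Real.exp (-c n))⁻¹ * Real.log n)) ∧
      ((fun n => d n ^ i n / n) =o[atTop] (fun n => Real.exp (-c n)) →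
        MetricDimensionAasLe p (fun n => Real.exp (c n) * Real.log n) ∧
        MetricDimensionAasLe p (fun n => 2 * Real.log n / Real.log (1 / q n)) ∧
        (fun n : ℕ => Real.exp (c n) * Real.log n) ~[atTop]
          (fun n : ℕ => 2 * Real.log n / Real.log (1 / q n))) ∧
      ((fun n => Real.exp (-c n)) =o[atTop] (fun n => d n ^ i n / n) →
        MetricDimensionAasLe p (fun n => n * Real.log n / d n ^ i n))) := by 
  have hlog0 : ∀ᶠ n : ℕ in atTop, 0 ≤ Real.log n :=
    tendsto_log_natCast.eventually_ge_atTop 0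
  -- If `p n = 1` then `n - d = 1`, contradicting `n - d ≫ log n` for large `n`; this keeps `q < 1`.
  have hdense : ((fun n => (p n : ℝ)) =Θ[atTop] fun _ => (1 : ℝ)) →
      ∃ a > 0, ∀ᶠ n in atTop, a ≤ (p n : ℝ) ∧ (p n : ℝ) < 1 := by
    intro h
    obtain ⟨a, ha, hpa⟩ := h.2.exists_pos
    refine ⟨a⁻¹, inv_pos.mpr ha, ?_⟩
    filter_upwards [hpa.bound, hd_compl.bound one_pos, tendsto_log_natCast.eventually_ge_atTop 2]
      with n h1 h2 h3
    rw [norm_one, Real.norm_of_nonneg (p n).2.1] at h1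
    refine ⟨by rwa [inv_le_iff_one_le_mul₀' ha], lt_of_le_of_ne (p n).2.2 fun h4 => ?_⟩
    rw [hd, avgDegree, h4, Real.norm_of_nonneg (by linarith)] at h2
    norm_num at h2
    linarith
  constructor
  · intro hcΘ
    obtain ⟨c₁, hc₁, hcb⟩ := hcΘ.2.exists_pos
    obtain ⟨c₂, hc₂, hcu⟩ := hcΘ.1.exists_pos
    have hc0 : ∀ᶠ n in atTop, 0 ≤ c n := by
      filter_upwards [eventually_ge_atTop 1] with n hn
      rw [hc]
      exact div_nonneg (pow_nonneg (hd n ▸ avgDegree_nonneg p hn) _) (Nat.cast_nonneg _)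
    have hcl : ∀ᶠ n in atTop, c₁⁻¹ ≤ c n := by
      filter_upwards [hcb.bound, hc0] with n h1 h2
      rw [norm_one, Real.norm_of_nonneg h2] at h1
      rwa [inv_le_iff_one_le_mul₀' hc₁]
    have hq01 : ∀ᶠ n in atTop, 1 / 2 ≤ q n ∧ q n < 1 := by
      rcases hq with ⟨-, hq⟩ | ⟨hp, hq⟩
      · filter_upwards [hcl] with n hn
        rw [hq]
        refine ⟨half_le_sq_add_sq _, sq_add_sq_lt_one (Real.exp_pos _) ?_⟩
        rw [← Real.exp_zero]
        exact Real.exp_lt_exp.mpr (by linarith [inv_pos.mpr hc₁])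
      · obtain ⟨a, ha, hpa⟩ := hdense hp
        filter_upwards [hpa] with n hn
        rw [hq]
        exact ⟨half_le_sq_add_sq _, sq_add_sq_lt_one (by linarith) hn.2⟩
    have hΩ : (fun n : ℕ => Real.log n) =O[atTop]
        (fun n : ℕ => 2 * Real.log n / Real.log (1 / q n)) := by
      refine IsBigO.of_bound 1 ?_
      filter_upwards [hq01, hlog0] with n hn hl
      have := two_mul_le_two_mul_div_log_inv hn.1 hn.2 hl
      rw [Real.norm_of_nonneg hl, Real.norm_of_nonneg (by linarith)]
      linarith
    refine ⟨?_, hΩ, fun hp1 => ⟨?_, hΩ⟩⟩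
    · rcases hq with ⟨hp, hq⟩ | ⟨hp, hq⟩
      · exact metricDimensionAasLe_of_bounded hd hd_large ((isLittleO_one_iff ℝ).mp hp) hi hc
          (inv_pos.mpr hc₁) hcl hq
      · obtain ⟨a, ha, hpa⟩ := hdense hp
        exact metricDimensionAasLe_of_dense hq (hpa.mono fun n hn => by linarith)
          (hpa.mono fun n hn => hn.2)
    -- In both cases `1 - q = 2 x (1 - x)`, with `x = e^{-c}` or `x = p`, and `x` stays away from
    -- `0` and `1`. Then `log (1 / q) ≥ 1 - q` is bounded below.
    · obtain ⟨m, hm, hqm⟩ : ∃ m > 0, ∀ᶠ n in atTop, m ≤ 1 - q n := by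
        rcases hq with ⟨-, hq⟩ | ⟨hp, hq⟩
        · have hlt : Real.exp (-c₁⁻¹) < 1 := by
            rw [← Real.exp_zero]
            exact Real.exp_lt_exp.mpr (by linarith [inv_pos.mpr hc₁])
          refine ⟨2 * (Real.exp (-c₂) * (1 - Real.exp (-c₁⁻¹))),
            mul_pos two_pos (mul_pos (Real.exp_pos _) (by linarith)), ?_⟩
          filter_upwards [hcl, hcu.bound, hc0] with n h1 h2 h3
          rw [norm_one, Real.norm_of_nonneg h3, mul_one] at h2
          have h4 : Real.exp (-c₂) ≤ Real.exp (-c n) := Real.exp_le_exp.mpr (by linarith)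
          have h5 : Real.exp (-c n) ≤ Real.exp (-c₁⁻¹) := Real.exp_le_exp.mpr (by linarith)
          have h6 := mul_le_mul h4 (by linarith : 1 - Real.exp (-c₁⁻¹) ≤ 1 - Real.exp (-c n))
            (by linarith) (Real.exp_nonneg _)
          rw [hq]
          linarith
        · obtain ⟨a, ha, hpa⟩ := hdense hp
          obtain ⟨b, hb, hpb⟩ := hp1.exists_pos
          refine ⟨2 * (a * b⁻¹), by positivity, ?_⟩
          filter_upwards [hpa, hpb.bound] with n h1 h2
          rw [norm_one, Real.norm_of_nonneg (by linarith [h1.2])] at h2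
          have h3 : b⁻¹ ≤ 1 - p n := by rwa [inv_le_iff_one_le_mul₀' hb]
          have h6 := mul_le_mul h1.1 h3 (by positivity) (by linarith [h1.1])
          rw [hq]
          linarith
      refine IsBigO.of_bound (2 / m) ?_
      filter_upwards [hq01, hlog0, hqm] with n hn hl hm'
      have hL := log_inv_pos hn.1 hn.2
      have h1 : m ≤ Real.log (1 / q n) := by
        rw [one_div, Real.log_inv]
        linarith [Real.log_le_sub_one_of_pos (by linarith [hn.1] : 0 < q n)]
      rw [Real.norm_of_nonneg hl, Real.norm_of_nonneg (by positivity), div_mul_eq_mul_div]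
      exact div_le_div_of_nonneg_left (by positivity) hm h1
  · intro hct
    obtain ⟨hp, hq⟩ : Tendsto (fun n => (p n : ℝ)) atTop (𝓝 0) ∧
        ∀ n, q n = Real.exp (-c n) ^ 2 + (1 - Real.exp (-c n)) ^ 2 := by
      rcases hq with ⟨hp, hq⟩ | ⟨hp, -⟩
      · exact ⟨(isLittleO_one_iff ℝ).mp hp, hq⟩
      · obtain ⟨a, ha, hpa⟩ := hdense hp
        exact absurd hct (hi.not_tendsto_of_dense hd hc ha (hpa.mono fun n hn => hn.1))
    have hx0 : Tendsto (fun n => Real.exp (-c n)) atTop (𝓝 0) :=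
      Real.tendsto_exp_neg_atTop_nhds_zero.comp hct
    have hg : Tendsto (fun n => d n ^ i n / n + Real.exp (-c n)) atTop (𝓝 0) := by
      simpa using hi.1.tendsto_div_nhds_zero.add hx0
    have hgpos : ∀ᶠ n in atTop, 0 < d n ^ i n / n + Real.exp (-c n) := by
      filter_upwards [eventually_ge_atTop 1] with n hn
      have : 0 ≤ d n ^ i n := pow_nonneg (hd n ▸ avgDegree_nonneg p hn) _
      have := Real.exp_pos (-c n)
      positivity
    have hmain := metricDimensionAasLe_of_tendsto_atTop hd hd_large hp hi hc hct hg
    refine ⟨hmain, ?_, fun hlit => ?_, fun hlit => ?_⟩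
    -- The quotient of the two sides is `d ^ i / n + e^{-c}`, which tends to `0`.
    · refine isLittleO_iff_exists_eq_mul.mpr ⟨_, hg, ?_⟩
      filter_upwards [hgpos] with n hn
      simp only [Pi.mul_apply]
      rw [mul_inv_cancel_left₀ hn.ne']
    · have h1 : (fun n => d n ^ i n / n + Real.exp (-c n)) ~[atTop] fun n => Real.exp (-c n) :=
        (IsEquivalent.refl.add_isLittleO hlit).congr_left
          (Eventually.of_forall fun n => add_comm _ _)
      have h2 : (fun n => (d n ^ i n / n + Real.exp (-c n))⁻¹ * Real.log n) ~[atTop]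
          fun n => Real.exp (c n) * Real.log n :=
        (inv_mul_isEquivalent h1 fun n => Real.log n).congr_right
          (Eventually.of_forall fun n => by simp only [Real.exp_neg, inv_inv])
      have h3 : (fun n : ℕ => Real.exp (c n) * Real.log n) ~[atTop]
          (fun n : ℕ => 2 * Real.log n / Real.log (1 / q n)) := by
        have h4 := inv_mul_isEquivalent
          (log_inv_isEquivalent (fun n => Real.exp_pos (-c n)) hx0).symm fun n => 2 * Real.log n
        refine (h4.congr_left (Eventually.of_forall fun n => ?_)).congr_right
          (Eventually.of_forall fun n => ?_)
        · simp only [Real.exp_neg]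
          field_simp
        · simp only [hq]
          ring
      have h6 := hmain.congr_isEquivalent h2
      exact ⟨h6, h6.congr_isEquivalent h3, h3⟩
    · have h1 : (fun n => d n ^ i n / n + Real.exp (-c n)) ~[atTop] fun n => d n ^ i n / n :=
        IsEquivalent.refl.add_isLittleO hlit
      refine hmain.congr_isEquivalent ((inv_mul_isEquivalent h1 fun n => Real.log n).congr_right
        (Eventually.of_forall fun n => ?_))
      simp only [inv_div]
      ring
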